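/- **Setting.** Let $\mathfrak g$ be a complex semisimple Lie algebra with Killing form $(\cdot,\cdot)$, $G^{sc}$ the simply connected complex Lie group with Lie algebra $\mathfrak g$, and $\mathcal O\subset\mathfrak g$ a nilpotent adjoint orbit which spans $\mathfrak g$. Let $\kappa:\mathcal M\to\mathcal O$ be a finite connected Galois covering with Galois group (group of deck transformations) $\mathcal S$. The adjoint action of $G^{sc}$ lifts to $\mathcal M$; let $G$ be the quotient of $G^{sc}$ by the subgroup that fixes $\mathcal M$ pointwise. The square $y\mapsto t^2y$ of the Euler dilation action of $\mathbb C^*$ also lifts to $\mathcal M$, and so does the Kirillov–Kostant–Souriau symplectic form. Let $R$ be the Poisson algebra of regular functions on $\mathcal M$ (equivalently, of $G$-finite holomorphic functions), graded by $R=\bigoplus_{j\in\frac12\mathbb N}R[j]$ with $R[j]=\{f: f(t\cdot m)=t^{2j}f(m)\}$. Put $\phi^x(m)=(x,\kappa(m))$ for $x\in\mathfrak g$, so that $\phi^x\in R[1]$ and $\{\phi^x,\phi^y\}=\phi^{[x,y]}$, and let $\alpha$ be the automorphism of $R$ with $\alpha(f)=i^{2j}f$ for $f\in R[j]$. Let $D$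 be an associative unital (not necessarily commutative) $\mathbb C$-algebra with the following data. 1. (I) An increasing algebra filtration $D=\bigcup_{j\in\frac12\mathbb N}D_j$ with $[D_j,D_k]\subseteq D_{j+k-1}$, where $D_j=0$ for $j<0$. 2. (II) A representation of $\mathcal S$ on $D$ by filtered algebra automorphisms; $D^{\mathcal S}$ denotes the subalgebra of invariants. 3. (III) An injective Lie algebra homomorphism $x\mapsto\psi^x$ from $\mathfrak g$ to $D^{\mathcal S}\cap D_1$ such that the representation $a\mapsto\psi^xa-a\psi^x$ of $\mathfrak g$ on $D$ is locally finite and exponentiates to a representation of $G$ on $D$ by algebra automorphisms. 4. (IV) An $\mathcal S$-equivariant isomorphism $\gamma:\operatorname{gr}D\to R$ of graded Poisson algebras which sends the class of $\psi^x$ in $\operatorname{gr}_1D=D_1/D_{1/2}$ to $\phi^x$. 5. (V) An $\mathcal S$-invariant filtered algebra anti-automorphism $\beta$ of $D$ such that $\beta(\psi^x)=\psi^{-x}$, $\beta$ induces $\gamma^{-1}\alpha\gamma$ on $\operatorname{gr}D$, and $\beta^4=1$. 6. (VI) The unique $G$-invariant linear map $T:D\to\mathbb C$ with $T(1)=1$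 is a supertrace for the $\mathbb Z_2$-grading of $D$ by the $\pm1$-eigenspaces of $\beta^2$: $T(ab)=(-1)^{|a||b|}T(ba)$ if $a,b$ are superhomogeneous of the same parity, and $T(ab)=0$ if they are of different parity. **Proposition.** $D$ is a simple ring if and only if $D^{\mathcal S}$ is a simple ring. -/

import Mathlib

open scoped Manifold ContDiff

noncomputable section

namespace Dixmier

/-! ### The adjoint action and nilpotent orbits

Throughout, `G` is a complex Lie group modelled on `E`; in the theorem it is the simply connected
complex group of the semisimple Lie algebra `LieAlg E G`. -/

section Group

variable (E : Type*) [NormedAddCommGroup E] [NormedSpace ℂ E]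
  (G : Type*) [TopologicalSpace G] [ChartedSpace E G] [Group G]

/-- The Lie algebra of the complex Lie group `G` (tangent space at `1`, with the bracket of
left-invariant vector fields). -/
abbrev LieAlg : Type _ := GroupLieAlgebra 𝓘(ℂ, E) G

variable {E G}

/-- The adjoint action: `Ad g` is the differential at `1` of `h ↦ g h g⁻¹`. -/
def Ad (g : G) (x : LieAlg E G) : LieAlg E G :=
  (mfderiv 𝓘(ℂ, E) 𝓘(ℂ, E) (fun h : G => g * h * g⁻¹) 1 x : E)

/-- The adjoint orbit of `e`, as a set. -/
def orbitSet (e : LieAlg E G) : Set (LieAlg E G) := Set.range fun g : G => Ad g e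

/-- The adjoint orbit `𝒪` of `e`, as a topological space. -/
def Orbit (e : LieAlg E G) : Type _ := {y : LieAlg E G // y ∈ orbitSet e}

/-- The underlying element of the Lie algebra of a point of the orbit. -/
def Orbit.val {e : LieAlg E G} (y : Orbit e) : LieAlg E G := Subtype.val y

/-- The orbit map `g ↦ Ad g e`. -/
def orbitMap (e : LieAlg E G) (g : G) : Orbit e := ⟨Ad g e, g, rfl⟩

/-- The orbit carries its topology as a homogeneous space, i.e. the quotient topology of `G`
(for nilpotent orbits, which are locally closed, it is the subspace topology). -/
instance (e : LieAlg E G) : TopologicalSpace (Orbit e) :=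
  TopologicalSpace.coinduced (orbitMap e) inferInstance

/-- The derivative at `1`, in the direction `x`, of a complex-valued function on `G`. -/
def derivAtOne (u : G → ℂ) (x : LieAlg E G) : ℂ :=
  (mfderiv 𝓘(ℂ, E) 𝓘(ℂ, ℂ) u 1 x : ℂ)

/-! ### Covers of the orbit -/

/-- A (finite) covering `κ : M → 𝒪` of the orbit `𝒪` of `e`, together with the two lifted
actions: the adjoint action of `G`, and the square of the Euler dilation action of `ℂˣ`.
For connected `M` the lifted actions are uniquely determined by the laws below. -/
structure OrbitCover (e : LieAlg E G) (M : Type*) [TopologicalSpace M] where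
  /-- the covering map -/
  κ : M → Orbit e
  isCoveringMap : IsCoveringMap κ
  finite_fiber : ∀ y, (κ ⁻¹' {y}).Finite
  /-- the lift of the adjoint action -/
  act : G →* (M ≃ₜ M)
  continuous_act : Continuous fun p : G × M => act p.1 p.2
  κ_act : ∀ g m, (κ (act g m)).val = Ad g (κ m).val
  /-- the lift of the square of the Euler dilation action -/
  euler : ℂˣ →* (M ≃ₜ M)
  continuous_euler : Continuous fun p : ℂˣ × M => euler p.1 p.2
  κ_euler : ∀ (t : ℂˣ) m, (κ (euler t m)).val = ((t : ℂ) ^ 2) • (κ m).val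

namespace OrbitCover

variable {e : LieAlg E G} {M : Type*} [TopologicalSpace M] (C : OrbitCover e M)

/-- The group of deck transformations of the cover; the Galois group `𝒮` if the cover is
Galois. -/
def deckGroup : Subgroup (M ≃ₜ M) where
  carrier := {s | ∀ m, C.κ (s m) = C.κ m}
  one_mem' _ := rfl
  mul_mem' {s t} hs ht m := (hs (t m)).trans (ht m)
  inv_mem' {s} hs m := by
    have h := hs (s⁻¹ m)
    rw [show s (s⁻¹ m) = m from s.apply_symm_apply m] at h
    exact h.symm

/-- The cover is Galois: the deck transformations act transitively on each fibre. -/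
def IsGalois : Prop := ∀ m m', C.κ m = C.κ m' → ∃ s ∈ C.deckGroup, s m = m'

/-- A function on `M` is holomorphic if all its pull-backs along the orbit maps `g ↦ g • m`
(holomorphic submersions `G → M`) are holomorphic. -/
def IsHolomorphic (f : M → ℂ) : Prop :=
  ∀ m, ContMDiff 𝓘(ℂ, E) 𝓘(ℂ, ℂ) ω fun g : G => f (C.act g m)

/-- The translation action of `G` on functions: `(g f)(m) = f (g⁻¹ m)`. -/
def translate (g : G) : (M → ℂ) →ₐ[ℂ] (M → ℂ) where
  toFun f m := f (C.act g⁻¹ m)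
  map_one' := rfl
  map_mul' _ _ := rfl
  map_zero' := rfl
  map_add' _ _ := rfl
  commutes' _ := rfl

/-- A function is `G`-finite if it lies in a finite-dimensional `G`-stable space of functions. -/
def IsGFinite (f : M → ℂ) : Prop :=
  ∃ V : Submodule ℂ (M → ℂ), V.FG ∧ f ∈ V ∧ ∀ g, ∀ v ∈ V, C.translate g v ∈ V

/-- The algebra `R = R(M)` of regular functions on the cover `M`: these are the `G`-finite
holomorphic functions. -/
def regularFunctions : Subalgebra ℂ (M → ℂ) where
  carrier := {f | C.IsHolomorphic f ∧ C.IsGFinite f}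
  algebraMap_mem' c := by
    refine ⟨fun m => contMDiff_const, Submodule.span ℂ {algebraMap ℂ (M → ℂ) c},
      Submodule.fg_span_singleton _, Submodule.mem_span_singleton_self _, fun g v hv => ?_⟩
    obtain ⟨a, rfl⟩ := Submodule.mem_span_singleton.1 hv
    rw [map_smul, AlgHom.commutes]
    exact hv
  add_mem' {a b} := by
    rintro ⟨ha, V, hV, haV, hVs⟩ ⟨hb, W, hW, hbW, hWs⟩
    refine ⟨fun m => (ha m).add (hb m), V ⊔ W, hV.sup hW,
      Submodule.add_mem_sup haV hbW, fun g v hv => ?_⟩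
    obtain ⟨y, hy, z, hz, rfl⟩ := Submodule.mem_sup.1 hv
    rw [map_add]
    exact Submodule.add_mem_sup (hVs g y hy) (hWs g z hz)
  mul_mem' {a b} := by
    rintro ⟨ha, V, hV, haV, hVs⟩ ⟨hb, W, hW, hbW, hWs⟩
    refine ⟨fun m => (ha m).mul (hb m), V * W, hV.mul hW,
      Submodule.mul_mem_mul haV hbW, fun g v hv => ?_⟩
    refine Submodule.mul_induction_on hv (fun y hy z hz => ?_) (fun y z hy hz => ?_)
    · rw [map_mul]
      exact Submodule.mul_mem_mul (hVs g y hy) (hWs g z hz)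
    · rw [map_add]
      exact Submodule.add_mem _ hy hz

/-- The component `R[n/2]` of the Euler grading: the regular functions `f` with
`f (t • m) = t ^ n * f m`, where `t • m` is the lift of the *square* of the Euler dilation. -/
def gradedPiece (n : ℤ) : Submodule ℂ (M → ℂ) where
  carrier := {f | f ∈ C.regularFunctions ∧
    ∀ (t : ℂˣ) m, f (C.euler t m) = (t : ℂ) ^ n * f m}
  zero_mem' := ⟨zero_mem _, fun t m => by simp⟩
  add_mem' {a b} ha hb := ⟨add_mem ha.1 hb.1, fun t m => by
    simp only [Pi.add_apply, ha.2 t m, hb.2 t m]; ring⟩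
  smul_mem' c f hf := ⟨Subalgebra.smul_mem _ hf.1 c, fun t m => by
    simp only [Pi.smul_apply, smul_eq_mul, hf.2 t m]; ring⟩

section Poisson

variable [CompleteSpace E] [LieGroup 𝓘(ℂ, E) ω G]

/-- The Hamiltonian function `φˣ(m) = (x, κ m)` for the Killing form. -/
def hamiltonian (x : LieAlg E G) (m : M) : ℂ :=
  killingForm ℂ (LieAlg E G) x (C.κ m).val

/-- `z` represents the differential of `f` at `m`: identifying `T_m M` with
`T_y 𝒪 = [𝔤, y]`, `y = κ m`, one has `df_m([x, y]) = (z, [x, y])` for all `x`. -/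
def IsCodifferential (f : M → ℂ) (m : M) (z : LieAlg E G) : Prop :=
  ∀ x : LieAlg E G,
    derivAtOne (fun g : G => f (C.act g m)) x =
      killingForm ℂ (LieAlg E G) z ⁅x, (C.κ m).val⁆

/-- A representative of the differential of `f` at `m`; it is well defined modulo the
centralizer of `κ m`. -/
def codifferential (f : M → ℂ) (m : M) : LieAlg E G :=
  Classical.epsilon (C.IsCodifferential f m)

/-- The Poisson bracket of the Kirillov-Kostant-Souriau symplectic form:
`{f, h}(m) = (κ m, [z, w])` where `z`, `w` represent `df_m`, `dh_m`.
In particular `{φˣ, φʸ} = φ^[x, y]`. -/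
def poisson (f h : M → ℂ) (m : M) : ℂ :=
  killingForm ℂ (LieAlg E G) (C.κ m).val ⁅C.codifferential f m, C.codifferential h m⁆

end Poisson

end OrbitCover

end Group

/-! ### Dixmier algebras -/

/-- The graded piece `F n / F (n - 1)` of the associated graded space of a filtration. -/
abbrev gr {D : Type*} [Ring D] [Algebra ℂ D] (F : ℤ → Submodule ℂ D) (n : ℤ) : Type _ :=
  ↥(F n) ⧸ (F (n - 1)).submoduleOf (F n)

/-- The natural projection `F n → F n / F (n - 1)`. -/
abbrev grProj {D : Type*} [Ring D] [Algebra ℂ D] (F : ℤ → Submodule ℂ D) (n : ℤ) :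
    ↥(F n) →ₗ[ℂ] gr F n :=
  ((F (n - 1)).submoduleOf (F n)).mkQ

section Algebra

variable {E : Type*} [NormedAddCommGroup E] [NormedSpace ℂ E] [CompleteSpace E]
  {G : Type*} [TopologicalSpace G] [ChartedSpace E G] [Group G] [LieGroup 𝓘(ℂ, E) ω G]
  {e : LieAlg E G} {M : Type*} [TopologicalSpace M]

/-- The data and the laws (I)-(V) of a perfect Dixmier algebra `D` for the cover `C`.
Half-integral indices are doubled: `F n` is the filtration space `D_{n/2}`, with `F n = 0` for
`n < 0`. -/
structure DixmierData (C : OrbitCover e M) (D : Type*) [Ring D] [Algebra ℂ D] where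
  /-- (I) the filtration -/
  F : ℤ → Submodule ℂ D
  F_neg : ∀ n < 0, F n = ⊥
  F_mono : Monotone F
  F_exhaust : ∀ a, ∃ n, a ∈ F n
  one_mem : (1 : D) ∈ F 0
  mul_mem : ∀ {m n : ℤ} {a b : D}, a ∈ F m → b ∈ F n → a * b ∈ F (m + n)
  comm_mem : ∀ {m n : ℤ} {a b : D}, a ∈ F m → b ∈ F n → a * b - b * a ∈ F (m + n - 2)
  /-- (II) the action of the Galois group by filtered algebra automorphisms -/
  galois : C.deckGroup →* (D ≃ₐ[ℂ] D)
  galois_mem : ∀ s {n : ℤ} {a : D}, a ∈ F n → galois s a ∈ F n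
  /-- (III) the embedding of the Lie algebra into the invariants of `D_1` -/
  ψ : LieAlg E G →ₗ[ℂ] D
  ψ_lie : ∀ x y : LieAlg E G, ψ ⁅x, y⁆ = ψ x * ψ y - ψ y * ψ x
  ψ_injective : Function.Injective ψ
  ψ_mem : ∀ x, ψ x ∈ F 2
  galois_ψ : ∀ s x, galois s (ψ x) = ψ x
  /-- (III) the representation of the group on `D` by algebra automorphisms; it factors through
  the quotient of `G` that acts effectively on `M`, is locally finite and holomorphic, and its
  differential is `a ↦ ψ x * a - a * ψ x` -/
  ρ : G →* (D ≃ₐ[ℂ] D)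
  ρ_factors : ∀ g, (∀ m, C.act g m = m) → ρ g = 1
  ρ_locallyFinite : ∀ a, ∃ V : Submodule ℂ D, V.FG ∧ a ∈ V ∧
    (∀ x, ∀ v ∈ V, ψ x * v - v * ψ x ∈ V) ∧ ∀ g, ∀ v ∈ V, ρ g v ∈ V
  ρ_holomorphic : ∀ (a : D) (l : D →ₗ[ℂ] ℂ),
    ContMDiff 𝓘(ℂ, E) 𝓘(ℂ, ℂ) ω fun g : G => l (ρ g a)
  ρ_deriv : ∀ (a : D) (l : D →ₗ[ℂ] ℂ) (x : LieAlg E G),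
    derivAtOne (fun g : G => l (ρ g a)) x = l (ψ x * a - a * ψ x)
  /-- (IV) the `𝒮`-equivariant isomorphism `γ : gr D ≃ R` of graded Poisson algebras -/
  γ : ∀ n : ℤ, gr F n ≃ₗ[ℂ] C.gradedPiece n
  γ_one : (γ 0 (grProj F 0 ⟨1, one_mem⟩) : M → ℂ) = 1
  γ_mul : ∀ {m n : ℤ} (a : F m) (b : F n),
    (γ (m + n) (grProj F (m + n) ⟨a * b, mul_mem a.2 b.2⟩) : M → ℂ) =
      (γ m (grProj F m a) : M → ℂ) * (γ n (grProj F n b) : M → ℂ)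
  γ_poisson : ∀ {m n : ℤ} (a : F m) (b : F n),
    (γ (m + n - 2) (grProj F (m + n - 2) ⟨a * b - b * a, comm_mem a.2 b.2⟩) : M → ℂ) =
      C.poisson (γ m (grProj F m a) : M → ℂ) (γ n (grProj F n b) : M → ℂ)
  γ_galois : ∀ (s : C.deckGroup) {n : ℤ} (a : F n) (p : M),
    (γ n (grProj F n ⟨galois s a, galois_mem s a.2⟩) : M → ℂ) p =
      (γ n (grProj F n a) : M → ℂ) ((s⁻¹ : C.deckGroup).1 p)
  γ_ψ : ∀ x, (γ 2 (grProj F 2 ⟨ψ x, ψ_mem x⟩) : M → ℂ) = C.hamiltonian x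
  /-- (V) the `𝒮`-invariant filtered algebra anti-automorphism -/
  β : D ≃ₗ[ℂ] D
  β_one : β 1 = 1
  β_mul : ∀ a b, β (a * b) = β b * β a
  β_mem : ∀ {n : ℤ} {a : D}, a ∈ F n → β a ∈ F n
  β_galois : ∀ s a, β (galois s a) = galois s (β a)
  β_ψ : ∀ x, β (ψ x) = ψ (-x)
  /-- (V)(b): on `gr D`, `β` induces the automorphism `f ↦ i ^ n f` (`f ∈ R[n/2]`) of `R` -/
  β_symbol : ∀ {n : ℤ} (a : F n),
    γ n (grProj F n ⟨β a, β_mem a.2⟩) = (Complex.I ^ n) • γ n (grProj F n a)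
  β_four : ∀ a, β (β (β (β a))) = a

namespace DixmierData

variable {C : OrbitCover e M} {D : Type*} [Ring D] [Algebra ℂ D] (A : DixmierData C D)

/-- The subalgebra `D^𝒮` of invariants of the Galois group. -/
def invariants : Subalgebra ℂ D where
  carrier := {a | ∀ s, A.galois s a = a}
  algebraMap_mem' c s := (A.galois s).commutes c
  add_mem' {a b} ha hb s := by rw [map_add, ha s, hb s]
  mul_mem' {a b} ha hb s := by rw [map_mul, ha s, hb s]

/-- `a` is even: it lies in the `+1`-eigenspace of `β²`. -/
def IsEven (a : D) : Prop := A.β (A.β a) = a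

/-- `a` is odd: it lies in the `-1`-eigenspace of `β²`. -/
def IsOdd (a : D) : Prop := A.β (A.β a) = -a

/-- `T` is a supertrace for the superalgebra structure given by `β²`. -/
structure IsSupertrace (T : D →ₗ[ℂ] ℂ) : Prop where
  even : ∀ a b, A.IsEven a → A.IsEven b → T (a * b) = T (b * a)
  odd : ∀ a b, A.IsOdd a → A.IsOdd b → T (a * b) = -T (b * a)
  even_odd : ∀ a b, A.IsEven a → A.IsOdd b → T (a * b) = 0
  odd_even : ∀ a b, A.IsOdd a → A.IsEven b → T (a * b) = 0

/-- (VI) The `G`-linear map `T : D → ℂ` with `T 1 = 1` is a supertrace.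
(Given (I)-(V), there is exactly one such `T`.) -/
def SupertraceAxiom : Prop :=
  ∀ T : D →ₗ[ℂ] ℂ, (∀ g a, T (A.ρ g a) = T a) → T 1 = 1 → A.IsSupertrace T

end DixmierData

end Algebra

end Dixmier

end

/-! Simplicity of both rings is controlled by one bilinear form, `T (a * b)`.

Let `𝔤` act on `D` by commutators with the `ψ x`. Its invariants are the scalars: the Poisson
bracket with `φˣ` is, up to sign, the infinitesimal action of `x`, so the symbol of an invariant is
constant on the connected homogeneous space `M`. Euler scaling then allows only degree zero, and
induction on the filtration finishes (`eq_algebraMap_of_commute`). A finite-dimensional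
representation of `𝔤` splits as `V^𝔤 ⊕ 𝔤V` (`isCompl_maxTrivSubmodule_lie_top`, by the Casimir
operator), so `D` is the sum of `ℂ` and the commutators. Hence `T` exists, is unique, is fixed by
`𝒮`, and kills every `𝔤`-stable subspace not containing `1`; in particular it kills proper ideals of
`D` and of `D^𝒮`.

By the supertrace property the radical `{a | T (a D) = 0}` is a two-sided ideal, proper because `T 1
= 1`. It contains every proper ideal of `D`, so `D` is simple exactly when it vanishes. If it
vanishes and `a` lies in a proper ideal of `D^𝒮`, then averaging `b` over `𝒮` turns `T (a * b)` into
a multiple of `T` on that ideal; so `a` is in the radical and is zero. Conversely, a nonzero radical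
is `𝒮`-stable and contains the product of the Galois conjugates of any of its nonzero elements. The
symbol of this norm is invariant, and nonzero since `R` is a domain. Averaging therefore leaves a
nonzero invariant in the radical (`exists_invariant_mem`), which would be a nonzero proper ideal of
a simple `D^𝒮` after intersection.

The analytic input is that the differential of `Ad` is the bracket (`hasFDerivAt_AdL`) and that
differentials of holomorphic functions on `M` kill centralizers, so that codifferentials exist. -/

noncomputable section

namespace Dixmier

/-! ### Invariants and coinvariants of representations of semisimple Lie algebras -/

section Casimir

open LieModule Module

variable (K L V : Type*) [Field K] [LieRing L] [LieAlgebra K L]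
  [AddCommGroup V] [Module K V] [LieRingModule L V] [LieModule K L V]

/-- The kernel of the trace form, as an ideal. -/
def traceKer : LieIdeal K L where
  __ := LinearMap.ker (traceForm K L V)
  lie_mem {x y} hy := by
    have hy' : traceForm K L V y = 0 := hy
    change traceForm K L V ⁅x, y⁆ = 0
    ext z
    rw [← lie_skew, map_neg, LinearMap.neg_apply, traceForm_apply_lie_apply, hy']
    simp

variable {K L V} in
theorem mem_traceKer {x : L} : x ∈ traceKer K L V ↔ ∀ y, traceForm K L V x y = 0 := by
  change traceForm K L V x = 0 ↔ _
  exact LinearMap.ext_iff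

/-- For a semisimple Lie algebra, there are families of vectors that are dual for the trace form
and span an ideal complementary to the kernel of the trace form. -/
theorem exists_trace_dual_families [FiniteDimensional K L] [LieAlgebra.IsKilling K L] :
    ∃ (n : ℕ) (b : Fin n → L) (d : Fin n → L), (n = 0 → traceForm K L V = 0) ∧
      (∀ i, traceForm K L V (b i) (d i) = 1) ∧
      (∀ (x : L) j, ⁅x, b j⁆ = ∑ i, traceForm K L V (d i) ⁅x, b j⁆ • b i) ∧
      (∀ (x : L) j, ⁅x, d j⁆ = ∑ i, traceForm K L V ⁅x, d j⁆ (b i) • d i) := by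
  set B := traceForm K L V with hB
  have hsymm : B.IsSymm := ⟨traceForm_comm K L V⟩
  let N : LieIdeal K L := traceKer K L V
  let J : LieIdeal K L := N.killingCompl
  have hc : IsCompl N J := LieIdeal.isCompl_killingCompl N
  let BJ : LinearMap.BilinForm K J := B.restrict J.toSubmodule
  have hBJ : ∀ x y : J, BJ x y = B x y := fun _ _ => rfl
  -- `L = N ⊕ J` and `B` vanishes against `N`, so an element of `J` orthogonal to `J` is orthogonal
  -- to everything and lies in `N ⊓ J = ⊥`.
  have hsep : ∀ x ∈ J, (∀ y ∈ J, B x y = 0) → x = 0 := by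
    intro x hx h
    have hxN : x ∈ N := by
      refine mem_traceKer.2 fun y => ?_
      have hy : y ∈ N ⊔ J := by rw [hc.sup_eq_top]; trivial
      obtain ⟨u, hu, w, hw, rfl⟩ := (LieSubmodule.mem_sup _ _ _).1 hy
      rw [map_add, ← hB, h w hw, add_zero, hsymm.eq]
      exact mem_traceKer.1 hu x
    have : x ∈ N ⊓ J := ⟨hxN, hx⟩
    rwa [hc.inf_eq_bot, LieSubmodule.mem_bot] at this
  have hnd : BJ.Nondegenerate := by
    have hs : BJ.IsSymm := ⟨fun x y => hsymm.eq x y⟩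
    rw [LinearMap.BilinForm.Nondegenerate, LinearMap.IsRefl.nondegenerate_iff_separatingLeft hs.isRefl]
    intro x hx
    exact Subtype.ext (hsep x x.2 fun y hy => hx ⟨y, hy⟩)
  let n := finrank K J
  let e : Basis (Fin n) K J := finBasis K J
  let f : Basis (Fin n) K J := BJ.dualBasis hnd e
  have hf : ∀ i j, B (f i) (e j) = if j = i then 1 else 0 := fun i j =>
    LinearMap.BilinForm.apply_dualBasis_left hnd e i j
  have h1 : ∀ x : J, (x : L) = ∑ i, B (f i) x • (e i : L) := by
    intro x
    conv_lhs => rw [← e.sum_repr x]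
    rw [AddSubmonoidClass.coe_finsetSum]
    refine Finset.sum_congr rfl fun i _ => ?_
    rw [Submodule.coe_smul]
    congr 1
    calc e.repr x i = BJ (f i) (∑ j, e.repr x j • e j) := by
          have hf' : ∀ j, BJ (f i) (e j) = if j = i then 1 else 0 := hf i
          rw [map_sum]
          simp only [map_smul, hf']
          simp
      _ = B (f i) x := by rw [e.sum_repr, hBJ]
  have h2 : ∀ x : J, (x : L) = ∑ i, B x (e i) • (f i : L) := by
    intro x
    conv_lhs => rw [← f.sum_repr x]
    rw [AddSubmonoidClass.coe_finsetSum]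
    refine Finset.sum_congr rfl fun i _ => ?_
    rw [Submodule.coe_smul]
    congr 1
    exact LinearMap.BilinForm.dualBasis_repr_apply hnd e x i
  refine ⟨n, fun i => e i, fun i => f i, fun hn => ?_, fun i => ?_, fun x j => ?_, fun x j => ?_⟩
  · have hJ : Subsingleton J := finrank_zero_iff.1 hn
    ext x y
    have hx : x ∈ N ⊔ J := by rw [hc.sup_eq_top]; trivial
    obtain ⟨u, hu, w, hw, rfl⟩ := (LieSubmodule.mem_sup _ _ _).1 hx
    have hw0 : w = 0 := congrArg Subtype.val (Subsingleton.elim (⟨w, hw⟩ : J) 0)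
    rw [hw0, add_zero]
    exact mem_traceKer.1 hu y
  · rw [hsymm.eq, hf, if_pos rfl]
  · exact h1 ⟨⁅x, (e j : L)⁆, J.lie_mem (e j).2⟩
  · exact h2 ⟨⁅x, (f j : L)⁆, J.lie_mem (f j).2⟩

/-- The Killing complement of the derived ideal brackets with itself into both summands, hence to
zero; a Killing Lie algebra has no nonzero abelian ideal. -/
theorem lie_top_top_eq_top [FiniteDimensional K L] [LieAlgebra.IsKilling K L] :
    ⁅(⊤ : LieIdeal K L), (⊤ : LieIdeal K L)⁆ = ⊤ := by
  set I := ⁅(⊤ : LieIdeal K L), (⊤ : LieIdeal K L)⁆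
  have hc : IsCompl I I.killingCompl := LieIdeal.isCompl_killingCompl I
  have hab : IsLieAbelian I.killingCompl := by
    rw [LieSubmodule.lie_abelian_iff_lie_self_eq_bot, ← le_bot_iff, ← hc.inf_eq_bot, le_inf_iff]
    exact ⟨LieSubmodule.mono_lie le_top le_top, LieSubmodule.lie_le_right _ _⟩
  have := LieAlgebra.IsKilling.ideal_eq_bot_of_isLieAbelian (R := K) I.killingCompl
  rw [← hc.sup_eq_top, this, sup_bot_eq]

/-- A representation with vanishing trace form of a semisimple Lie algebra is trivial. -/
theorem isTrivial_of_traceForm_eq_zero [CharZero K] [FiniteDimensional K L]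
    [LieAlgebra.IsKilling K L] [FiniteDimensional K V] (h : traceForm K L V = 0) :
    IsTrivial L V := by
  have hd : LieAlgebra.derivedSeries K L 1 = ⊤ := lie_top_top_eq_top K L
  -- Cartan's criterion: with zero trace form the derived algebra, here all of `L`, acts
  -- nilpotently.
  have hnil := LieModule.isNilpotent_derivedSeries_of_traceForm_eq_zero h
  rw [hd] at hnil
  have hnil' : LieModule.IsNilpotent L V := (LieModule.isNilpotent_of_top_iff (R := K)).1 hnil
  obtain ⟨k, hk⟩ := (isNilpotent_iff K L V).1 hnil'
  -- Since `L = [L, L]`, the lower central series of `V` is stationary from its first step, so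
  -- nilpotency forces `[L, V] = 0`.
  have h12 : ⁅(⊤ : LieIdeal K L), (⊤ : LieSubmodule K L V)⁆ ≤
      ⁅(⊤ : LieIdeal K L), ⁅(⊤ : LieIdeal K L), (⊤ : LieSubmodule K L V)⁆⁆ := by
    conv_lhs => rw [← lie_top_top_eq_top K L]
    rw [LieSubmodule.lieIdeal_oper_eq_span, LieSubmodule.lieSpan_le]
    rintro _ ⟨⟨x, hx⟩, ⟨v, -⟩, rfl⟩
    change ⁅x, v⁆ ∈ _
    rw [← LieSubmodule.mem_toSubmodule, LieSubmodule.lieIdeal_oper_eq_linear_span'] at hx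
    induction hx using Submodule.span_induction with
    | mem x hx =>
      obtain ⟨y, -, z, -, rfl⟩ := hx
      rw [lie_lie]
      have aux : ∀ y z : L, ⁅y, ⁅z, v⁆⁆ ∈
          ⁅(⊤ : LieIdeal K L), ⁅(⊤ : LieIdeal K L), (⊤ : LieSubmodule K L V)⁆⁆ := fun y z =>
        LieSubmodule.lie_mem_lie (LieSubmodule.mem_top y)
          (LieSubmodule.lie_mem_lie (LieSubmodule.mem_top z) (LieSubmodule.mem_top v))
      exact sub_mem (aux y z) (aux z y)
    | zero => rw [zero_lie]; exact zero_mem _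
    | add x y _ _ hx hy => rw [add_lie]; exact add_mem hx hy
    | smul a x _ hx => rw [smul_lie]; exact Submodule.smul_mem _ _ hx
  have key : ∀ j, ⁅(⊤ : LieIdeal K L), (⊤ : LieSubmodule K L V)⁆ ≤
      lowerCentralSeries K L V j := by
    intro j
    induction j with
    | zero => exact le_top
    | succ j ih =>
      rw [LieModule.lowerCentralSeries_succ]
      exact h12.trans (LieSubmodule.mono_lie_right _ ih)
  refine ⟨fun x v => ?_⟩
  have := key k (LieSubmodule.lie_mem_lie (LieSubmodule.mem_top x) (LieSubmodule.mem_top v))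
  rwa [hk, LieSubmodule.mem_bot] at this

/-- If the trace form of `V` is not zero, then some multiple of the Casimir operator gives an
equivariant endomorphism of `V` that is not nilpotent, has image in `L V`, and kills the
invariants. -/
theorem exists_casimir [CharZero K] [FiniteDimensional K L]
    [LieAlgebra.IsKilling K L] [FiniteDimensional K V] (h : traceForm K L V ≠ 0) :
    ∃ c : V →ₗ⁅K, L⁆ V, ¬ IsNilpotent (c : V →ₗ[K] V) ∧
      (∀ v, c v ∈ ⁅(⊤ : LieIdeal K L), (⊤ : LieSubmodule K L V)⁆) ∧
      ∀ v ∈ maxTrivSubmodule K L V, c v = 0 := by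
  obtain ⟨n, b, d, hn, hbd, hb, hd⟩ := exists_trace_dual_families K L V
  let φ := toEnd K L V
  let c₀ : V →ₗ[K] V := ∑ i, φ (b i) ∘ₗ φ (d i)
  have hc₀ : ∀ v, c₀ v = ∑ i, ⁅b i, ⁅d i, v⁆⁆ := fun v => by
    simp [c₀, φ, LinearMap.sum_apply]
  have hcomm : ∀ (x : L) v, c₀ ⁅x, v⁆ = ⁅x, c₀ v⁆ := by
    intro x v
    rw [hc₀, hc₀, ← sub_eq_zero, ← neg_eq_zero, neg_sub, lie_sum, ← Finset.sum_sub_distrib]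
    -- Expanding in the dual families gives two double sums, which cancel after exchanging indices
    -- by invariance of the trace form.
    have : ∀ i, ⁅x, ⁅b i, ⁅d i, v⁆⁆⁆ - ⁅b i, ⁅d i, ⁅x, v⁆⁆⁆ =
        (∑ j, traceForm K L V (d j) ⁅x, b i⁆ • ⁅b j, ⁅d i, v⁆⁆) +
        ∑ j, traceForm K L V ⁅x, d i⁆ (b j) • ⁅b i, ⁅d j, v⁆⁆ := by
      intro i
      have e1 : ⁅⁅x, b i⁆, ⁅d i, v⁆⁆ =
          ∑ j, traceForm K L V (d j) ⁅x, b i⁆ • ⁅b j, ⁅d i, v⁆⁆ := by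
        conv_lhs => rw [hb x i]
        rw [sum_lie]
        simp_rw [smul_lie]
      have e2 : ⁅b i, ⁅⁅x, d i⁆, v⁆⁆ =
          ∑ j, traceForm K L V ⁅x, d i⁆ (b j) • ⁅b i, ⁅d j, v⁆⁆ := by
        conv_lhs => rw [hd x i]
        rw [sum_lie, lie_sum]
        simp_rw [smul_lie, lie_smul]
      rw [← e1, ← e2, lie_lie, lie_lie, lie_sub]
      abel
    rw [Finset.sum_congr rfl fun i _ => this i, Finset.sum_add_distrib, Finset.sum_comm,
      ← Finset.sum_add_distrib]
    refine Finset.sum_eq_zero fun i _ => ?_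
    rw [← Finset.sum_add_distrib]
    refine Finset.sum_eq_zero fun j _ => ?_
    rw [← add_smul, traceForm_apply_lie_apply', add_neg_cancel, zero_smul]
  let c : V →ₗ⁅K, L⁆ V := { c₀ with map_lie' := fun {x v} => hcomm x v }
  refine ⟨c, fun hnil => ?_, fun v => ?_, fun v hv => ?_⟩
  -- The trace of `c₀` is the size `n` of the families, so in characteristic zero nilpotency would
  -- give `n = 0`.
  · have h0 : LinearMap.trace K V c₀ = 0 :=
      (LinearMap.isNilpotent_trace_of_isNilpotent hnil).eq_zero
    rw [map_sum] at h0
    have : ∀ i, LinearMap.trace K V (φ (b i) ∘ₗ φ (d i)) = 1 := hbd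
    simp only [this, Finset.sum_const, Finset.card_univ, Fintype.card_fin, nsmul_eq_mul, mul_one,
      Nat.cast_eq_zero] at h0
    exact h (hn h0)
  · change c₀ v ∈ _
    rw [hc₀]
    exact sum_mem fun i _ => LieSubmodule.lie_mem_lie (LieSubmodule.mem_top _)
      (LieSubmodule.mem_top _)
  · change c₀ v = 0
    rw [hc₀]
    refine Finset.sum_eq_zero fun i _ => ?_
    rw [(mem_maxTrivSubmodule K L V v).1 hv, lie_zero]

/-- A finite-dimensional representation of a semisimple Lie algebra is the direct sum of its
invariants and of the image of the Lie algebra. -/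
theorem isCompl_maxTrivSubmodule_lie_top [CharZero K] [FiniteDimensional K L]
    [LieAlgebra.IsKilling K L] [FiniteDimensional K V] :
    IsCompl (maxTrivSubmodule K L V) ⁅(⊤ : LieIdeal K L), (⊤ : LieSubmodule K L V)⁆ := by
  induction hn : finrank K V using Nat.strong_induction_on generalizing V with
  | _ n ih =>
  by_cases h : traceForm K L V = 0
  · have := isTrivial_of_traceForm_eq_zero K L V h
    rw [(isTrivial_iff_max_triv_eq_top K L V).1 this,
      (LieSubmodule.lie_eq_bot_iff _ _).2 fun x _ v _ => trivial_lie_zero _ _ x v]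
    exact isCompl_top_bot
  obtain ⟨c, hc, hcL, hcT⟩ := exists_casimir K L V h
  -- Fitting decomposition `V = ker c ^ k ⊕ range c ^ k`. With `k > 0` the range lies in `[L, V]`
  -- and the invariants lie in the kernel. The kernel is proper since `c` is not nilpotent, so
  -- induction applies to it.
  obtain ⟨k, hk, hk0⟩ := ((c : V →ₗ[K] V).eventually_isCompl_ker_pow_range_pow.and
    (Filter.eventually_gt_atTop 0)).exists
  have hkL : ∀ (x : L) v, ((c : V →ₗ[K] V) ^ k) ⁅x, v⁆ = ⁅x, ((c : V →ₗ[K] V) ^ k) v⁆ := by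
    intro x v
    clear hk hk0
    induction k with
    | zero => rfl
    | succ k ih =>
      rw [pow_succ', Module.End.mul_apply, Module.End.mul_apply, ih]
      exact c.map_lie _ _
  let V₀ : LieSubmodule K L V :=
    { LinearMap.ker ((c : V →ₗ[K] V) ^ k) with
      lie_mem := fun {x v} hv => by
        change ((c : V →ₗ[K] V) ^ k) v = 0 at hv
        change ((c : V →ₗ[K] V) ^ k) ⁅x, v⁆ = 0
        rw [hkL, hv, lie_zero] }
  have hV₀ : ∀ v, v ∈ V₀ ↔ ((c : V →ₗ[K] V) ^ k) v = 0 := fun v => Iff.rfl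
  have hlt : finrank K V₀ < n := by
    rw [← hn]
    refine Submodule.finrank_lt (s := V₀.toSubmodule) (fun htop => hc ⟨k, ?_⟩)
    exact LinearMap.ker_eq_top.1 htop
  have hV := ih _ hlt (V := V₀) rfl
  obtain ⟨l, rfl⟩ : ∃ l, k = l + 1 := ⟨k - 1, by omega⟩
  have hsplit : ∀ v : V, ∃ a ∈ V₀, ∃ w, v = a + ((c : V →ₗ[K] V) ^ (l + 1)) w := by
    intro v
    have hv : v ∈ LinearMap.ker ((c : V →ₗ[K] V) ^ (l + 1)) ⊔
        LinearMap.range ((c : V →ₗ[K] V) ^ (l + 1)) := by rw [hk.sup_eq_top]; trivial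
    obtain ⟨a, ha, _, ⟨w, rfl⟩, rfl⟩ := Submodule.mem_sup.1 hv
    exact ⟨a, ha, w, rfl⟩
  constructor
  · rw [disjoint_iff, LieSubmodule.eq_bot_iff]
    rintro u ⟨hu, huL⟩
    -- The Fitting projection is equivariant, so it sends `[L, V]` into `[L, V₀]`.
    have hproj : ∀ v ∈ ⁅(⊤ : LieIdeal K L), (⊤ : LieSubmodule K L V)⁆,
        ∃ a : V₀, a ∈ ⁅(⊤ : LieIdeal K L), (⊤ : LieSubmodule K L V₀)⁆ ∧
          ∃ w, v = a + ((c : V →ₗ[K] V) ^ (l + 1)) w := by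
      intro v hv
      rw [← LieSubmodule.mem_toSubmodule, LieSubmodule.lieIdeal_oper_eq_linear_span'] at hv
      induction hv using Submodule.span_induction with
      | mem v hv =>
        obtain ⟨x, -, v, -, rfl⟩ := hv
        obtain ⟨a, ha, w, rfl⟩ := hsplit v
        refine ⟨⁅x, (⟨a, ha⟩ : V₀)⁆, LieSubmodule.lie_mem_lie (LieSubmodule.mem_top _)
          (LieSubmodule.mem_top _), ⁅x, w⁆, ?_⟩
        rw [lie_add, hkL]
        rfl
      | zero => exact ⟨0, zero_mem _, 0, by simp⟩
      | add v₁ v₂ _ _ h₁ h₂ =>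
        obtain ⟨a₁, ha₁, w₁, rfl⟩ := h₁
        obtain ⟨a₂, ha₂, w₂, rfl⟩ := h₂
        refine ⟨a₁ + a₂, add_mem ha₁ ha₂, w₁ + w₂, ?_⟩
        rw [map_add, LieSubmodule.coe_add]
        abel
      | smul r v _ h =>
        obtain ⟨a, ha, w, rfl⟩ := h
        exact ⟨r • a, Submodule.smul_mem _ _ ha, r • w, by rw [map_smul, smul_add]; rfl⟩
    obtain ⟨a, ha, w, hw⟩ := hproj u huL
    have hu₀ : u ∈ V₀ := by
      rw [hV₀, pow_succ, Module.End.mul_apply]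
      have : (c : V →ₗ[K] V) u = 0 := hcT u hu
      rw [this, map_zero]
    have hwbot : u - a ∈ LinearMap.ker ((c : V →ₗ[K] V) ^ (l + 1)) ⊓
        LinearMap.range ((c : V →ₗ[K] V) ^ (l + 1)) :=
      ⟨V₀.sub_mem hu₀ a.2, w, by rw [hw]; abel⟩
    rw [hk.inf_eq_bot, Submodule.mem_bot, sub_eq_zero] at hwbot
    have ha' : a ∈ maxTrivSubmodule K L V₀ ⊓ ⁅(⊤ : LieIdeal K L), (⊤ : LieSubmodule K L V₀)⁆ := by
      refine ⟨fun x => Subtype.ext ?_, ha⟩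
      rw [LieSubmodule.coe_bracket, ← hwbot]
      exact hu x
    rw [hV.inf_eq_bot, LieSubmodule.mem_bot] at ha'
    rw [hwbot, ha']
    rfl
  · rw [codisjoint_iff, eq_top_iff]
    intro v _
    obtain ⟨a, ha, w, rfl⟩ := hsplit v
    have ha' : (⟨a, ha⟩ : V₀) ∈
        maxTrivSubmodule K L V₀ ⊔ ⁅(⊤ : LieIdeal K L), (⊤ : LieSubmodule K L V₀)⁆ := by
      rw [hV.sup_eq_top]; trivial
    obtain ⟨t, ht, z, hz, htz⟩ := (LieSubmodule.mem_sup _ _ _).1 ha'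
    have hz' : (z : V) ∈ ⁅(⊤ : LieIdeal K L), (⊤ : LieSubmodule K L V)⁆ := by
      have : ⁅(⊤ : LieIdeal K L), (⊤ : LieSubmodule K L V₀)⁆ ≤
          ⁅(⊤ : LieIdeal K L), (⊤ : LieSubmodule K L V)⁆.comap V₀.incl := by
        rw [LieSubmodule.lieIdeal_oper_eq_span, LieSubmodule.lieSpan_le]
        rintro _ ⟨⟨x, hx⟩, ⟨v, -⟩, rfl⟩
        exact LieSubmodule.lie_mem_lie (LieSubmodule.mem_top x) (LieSubmodule.mem_top (v : V))
      exact this hz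
    have htz' : a = t + z := congrArg Subtype.val htz.symm
    rw [htz', add_assoc]
    refine add_mem ((le_sup_left : _ ≤ maxTrivSubmodule K L V ⊔ _) ?_)
      ((le_sup_right : _ ≤ maxTrivSubmodule K L V ⊔ _) (add_mem hz' ?_))
    · exact fun x => congrArg Subtype.val (ht x)
    · rw [pow_succ', Module.End.mul_apply]
      exact hcL _

end Casimir

/-! ### The differential of conjugation in local coordinates -/

section LocalGroup

open Filter Topology

variable {E : Type*} [NormedAddCommGroup E] [NormedSpace ℂ E]

/-- In local coordinates `m` for a Lie group, the value at `a` of the left-invariant vector field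
with value `w` at the identity `e₀`. -/
def localLeftField (m : E × E → E) (e₀ : E) (w a : E) : E :=
  fderiv ℂ m (a, e₀) (0, w)

variable {m K : E × E → E} {e₀ : E}

theorem hasFDerivAt_localLeftField (hm : ContDiffAt ℂ ω m (e₀, e₀)) (w : E) :
    HasFDerivAt (localLeftField m e₀ w)
      (((fderiv ℂ (fderiv ℂ m) (e₀, e₀)).comp (ContinuousLinearMap.inl ℂ E E)).flip (0, w)) e₀ := by
  have h1 : HasFDerivAt (fderiv ℂ m) (fderiv ℂ (fderiv ℂ m) (e₀, e₀)) (e₀, e₀) :=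
    ((hm.fderiv_right (m := ω) (by simp)).differentiableAt (by simp)).hasFDerivAt
  have h2 : HasFDerivAt (fun a : E => (a, e₀)) (ContinuousLinearMap.inl ℂ E E) e₀ :=
    hasFDerivAt_prodMk_left _ _
  have h3 := (HasFDerivAt.comp e₀ (f := fun a : E => (a, e₀)) h1 h2).clm_apply
    (hasFDerivAt_const ((0 : E), w) e₀)
  refine h3.congr_fderiv ?_
  ext v
  simp

theorem contDiffAt_localLeftField (hm : ContDiffAt ℂ ω m (e₀, e₀)) (w : E) :
    ContDiffAt ℂ ω (localLeftField m e₀ w) e₀ :=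
  (ContDiffAt.comp e₀ (f := fun a : E => (a, e₀)) (hm.fderiv_right (m := ω) (by simp))
    (contDiff_id.prodMk contDiff_const).contDiffAt).clm_apply contDiffAt_const

/-- If `K (a, b) = a b a⁻¹` in local coordinates for a Lie group, then the differential of
`a ↦ (∂_b K) (a, e₀) y` at the identity `e₀` is given by the Lie bracket of left-invariant vector
fields. -/
theorem hasFDerivAt_local_conj (hm : ContDiffAt ℂ ω m (e₀, e₀)) (hK : ContDiffAt ℂ ω K (e₀, e₀))
    (hmr : ∀ᶠ a in 𝓝 e₀, m (a, e₀) = a)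
    (hKl : ∀ᶠ b in 𝓝 e₀, K (e₀, b) = b) (hKr : ∀ᶠ a in 𝓝 e₀, K (a, e₀) = e₀)
    (hmK : ∀ᶠ p in 𝓝 (e₀, e₀), m (K p, p.1) = m p) (y : E) :
    ∃ F' : E →L[ℂ] E, HasFDerivAt (fun a => fderiv ℂ K (a, e₀) (0, y)) F' e₀ ∧
      ∀ v, F' v = fderiv ℂ (localLeftField m e₀ y) e₀ v - fderiv ℂ (localLeftField m e₀ v) e₀ y := by
  set D2 := fderiv ℂ (fderiv ℂ m) (e₀, e₀)
  have hF := hasFDerivAt_localLeftField hK y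
  refine ⟨_, hF, fun v => ?_⟩
  set F' := ((fderiv ℂ (fderiv ℂ K) (e₀, e₀)).comp (ContinuousLinearMap.inl ℂ E E)).flip (0, y)
  change HasFDerivAt (fun a => fderiv ℂ K (a, e₀) (0, y)) F' e₀ at hF
  rw [(hasFDerivAt_localLeftField hm y).fderiv, (hasFDerivAt_localLeftField hm v).fderiv]
  change F' v = D2 (v, 0) (0, y) - D2 (y, 0) (0, v)
  have hsymm : D2 (y, 0) (0, v) = D2 (0, v) (y, 0) := hm.isSymmSndFDerivAt (by simp) _ _
  rw [hsymm]
  have hm1 : HasFDerivAt (fderiv ℂ m) D2 (e₀, e₀) :=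
    ((hm.fderiv_right (m := ω) (by simp)).differentiableAt (by simp)).hasFDerivAt
  have hl : Tendsto (fun a : E => (a, e₀)) (𝓝 e₀) (𝓝 (e₀, e₀)) :=
    (continuous_id.prodMk continuous_const).tendsto _
  have hr : Tendsto (fun a : E => (e₀, a)) (𝓝 e₀) (𝓝 (e₀, e₀)) :=
    (continuous_const.prodMk continuous_id).tendsto _
  have hdm : ∀ᶠ p in 𝓝 (e₀, e₀), DifferentiableAt ℂ m p :=
    (hm.eventually (by simp)).mono fun p hp => hp.differentiableAt (by simp)
  have hdK : ∀ᶠ p in 𝓝 (e₀, e₀), DifferentiableAt ℂ K p :=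
    (hK.eventually (by simp)).mono fun p hp => hp.differentiableAt (by simp)
  -- Differentiate `m (K (a, b), a) = m (a, b)` in `b` at `e₀`. Differentiating the result in `a` at
  -- `e₀` gives `huniq`, which relates `F'` to the mixed second derivatives of `m`.
  have hrel : ∀ᶠ a in 𝓝 e₀, fderiv ℂ m (e₀, a) (fderiv ℂ K (a, e₀) (0, y), 0) =
      localLeftField m e₀ y a := by
    filter_upwards [hl.eventually hdm, hr.eventually hdm, hl.eventually hdK, hKr,
      (nhds_prod_eq (x := e₀) (y := e₀) ▸ hmK).curry] with a h1 h2 h3 h4 h5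
    have hin : HasFDerivAt (fun b : E => (a, b)) (ContinuousLinearMap.inr ℂ E E) e₀ :=
      hasFDerivAt_prodMk_right _ _
    have hR : HasFDerivAt (fun b => m (a, b)) _ e₀ :=
      HasFDerivAt.comp e₀ (f := fun b : E => (a, b)) h1.hasFDerivAt hin
    have hKin : HasFDerivAt (fun b => K (a, b)) _ e₀ :=
      HasFDerivAt.comp e₀ (f := fun b : E => (a, b)) h3.hasFDerivAt hin
    have hpair := hKin.prodMk (hasFDerivAt_const a e₀)
    rw [← h4] at h2
    have hL : HasFDerivAt (fun b => m (K (a, b), a)) _ e₀ :=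
      HasFDerivAt.comp e₀ (f := fun b : E => (K (a, b), a)) h2.hasFDerivAt hpair
    have := (hL.congr_of_eventuallyEq (h5.mono fun b hb => hb.symm)).unique hR
    have h6 := congrArg (fun f : E →L[ℂ] E => f y) this
    simpa [h4, localLeftField] using h6
  have hRF : HasFDerivAt (fun a => fderiv ℂ m (e₀, a) (fderiv ℂ K (a, e₀) (0, y), 0)) _ e₀ :=
    (HasFDerivAt.comp e₀ (f := fun a : E => (e₀, a)) hm1
      (hasFDerivAt_prodMk_right e₀ e₀)).clm_apply (hF.prodMk (hasFDerivAt_const (0 : E) e₀))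
  have huniq := (hRF.congr_of_eventuallyEq (hrel.mono fun _ h => h.symm)).unique
    (hasFDerivAt_localLeftField hm y)
  have h7 := congrArg (fun f : E →L[ℂ] E => f v) huniq
  have hK1 : fderiv ℂ K (e₀, e₀) (0, y) = y := by
    have hin : HasFDerivAt (fun b : E => (e₀, b)) (ContinuousLinearMap.inr ℂ E E) e₀ :=
      hasFDerivAt_prodMk_right _ _
    have h : HasFDerivAt (fun b => K (e₀, b)) _ e₀ :=
      HasFDerivAt.comp e₀ (f := fun b : E => (e₀, b))
        (hK.differentiableAt (by simp)).hasFDerivAt hin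
    have := (h.congr_of_eventuallyEq (hKl.mono fun _ h => h.symm)).unique (hasFDerivAt_id e₀)
    simpa using congrArg (fun f : E →L[ℂ] E => f y) this
  have hm2 : ∀ z, fderiv ℂ m (e₀, e₀) (z, 0) = z := by
    intro z
    have hin : HasFDerivAt (fun b : E => (b, e₀)) (ContinuousLinearMap.inl ℂ E E) e₀ :=
      hasFDerivAt_prodMk_left _ _
    have h : HasFDerivAt (fun b => m (b, e₀)) _ e₀ :=
      HasFDerivAt.comp e₀ (f := fun b : E => (b, e₀))
        (hm.differentiableAt (by simp)).hasFDerivAt hin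
    have := (h.congr_of_eventuallyEq (hmr.mono fun _ h => h.symm)).unique (hasFDerivAt_id e₀)
    simpa using congrArg (fun f : E →L[ℂ] E => f z) this
  have h8 : F' v + D2 (0, v) (y, 0) = D2 (v, 0) (0, y) := by
    simpa [hK1, hm2] using h7
  rw [← h8, add_sub_cancel_right]

end LocalGroup

/-! ### The adjoint representation -/

section LieGroup

open Filter Topology Set

variable {E : Type*} [NormedAddCommGroup E] [NormedSpace ℂ E]
  {G : Type*} [TopologicalSpace G] [ChartedSpace E G] [Group G]

variable (E G) in
/-- The preferred chart at the identity. -/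
abbrev chartOne : PartialEquiv G E := extChartAt 𝓘(ℂ, E) (1 : G)

variable (E G) in
/-- The image of the identity in its preferred chart. -/
abbrev baseOne : E := chartOne E G 1

variable (E G) in
/-- The multiplication in the chart at the identity. -/
def chartMul (p : E × E) : E := chartOne E G ((chartOne E G).symm p.1 * (chartOne E G).symm p.2)

variable (E) in
/-- The conjugation by `g` in the chart at the identity. -/
def chartConj (g : G) (b : E) : E := chartOne E G (g * (chartOne E G).symm b * g⁻¹)

variable (E G) in
theorem chartOne_symm_baseOne : (chartOne E G).symm (baseOne E G) = 1 :=
  extChartAt_to_inv (I := 𝓘(ℂ, E)) (1 : G)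

theorem chartConj_baseOne (g : G) : chartConj E g (baseOne E G) = baseOne E G := by
  rw [chartConj, chartOne_symm_baseOne, mul_one, mul_inv_cancel]

variable (E G) in
theorem eventually_mem_target : ∀ᶠ a in 𝓝 (baseOne E G), a ∈ (chartOne E G).target :=
  extChartAt_target_mem_nhds (I := 𝓘(ℂ, E)) (1 : G)

variable (E G) in
theorem contMDiffAt_chartOne : ContMDiffAt 𝓘(ℂ, E) 𝓘(ℂ, E) ω (chartOne E G) 1 :=
  contMDiffAt_extChartAt

theorem mfderiv_one_eq {F : Type*} [NormedAddCommGroup F] [NormedSpace ℂ F] {u : G → F}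
    (hu : MDifferentiableAt 𝓘(ℂ, E) 𝓘(ℂ, F) u 1) :
    (mfderiv 𝓘(ℂ, E) 𝓘(ℂ, F) u 1 : E →L[ℂ] F) =
      fderiv ℂ (fun b => u ((chartOne E G).symm b)) (baseOne E G) := by
  simp [mfderiv, hu, writtenInExtChartAt, Function.comp_def]
  rfl

/-- The adjoint action as a continuous linear map. -/
def AdL (g : G) : E →L[ℂ] E := fderiv ℂ (chartConj E g) (baseOne E G)

theorem AdL_one : AdL (1 : G) = ContinuousLinearMap.id ℂ E := by
  refine ((hasFDerivAt_id _).congr_of_eventuallyEq ?_).fderiv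
  filter_upwards [eventually_mem_target E G] with b hb
  simp only [chartConj, one_mul, inv_one, mul_one, id]
  exact (chartOne E G).right_inv hb

variable (E G) in
theorem eventually_chartMul_right :
    ∀ᶠ a in 𝓝 (baseOne E G), chartMul E G (a, baseOne E G) = a := by
  filter_upwards [eventually_mem_target E G] with a ha
  rw [chartMul, chartOne_symm_baseOne, mul_one]
  exact (chartOne E G).right_inv ha

variable (E G) in
theorem eventually_chartMul_left :
    ∀ᶠ a in 𝓝 (baseOne E G), chartMul E G (baseOne E G, a) = a := by
  filter_upwards [eventually_mem_target E G] with a ha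
  rw [chartMul, chartOne_symm_baseOne, one_mul]
  exact (chartOne E G).right_inv ha

variable [LieGroup 𝓘(ℂ, E) ω G]

variable (E G) in
theorem contMDiffAt_chartOne_symm :
    ContMDiffAt 𝓘(ℂ, E) 𝓘(ℂ, E) ω (chartOne E G).symm (baseOne E G) :=
  (contMDiffOn_extChartAt_symm (I := 𝓘(ℂ, E)) (n := ω) (1 : G)).contMDiffAt
    (extChartAt_target_mem_nhds (I := 𝓘(ℂ, E)) (1 : G))

theorem contMDiff_conj (g : G) : ContMDiff 𝓘(ℂ, E) 𝓘(ℂ, E) ω fun h : G => g * h * g⁻¹ :=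
  (contMDiff_const.mul contMDiff_id).mul contMDiff_const

theorem Ad_eq_fderiv (g : G) (y : LieAlg E G) :
    Ad g y = fderiv ℂ (chartConj E g) (baseOne E G) y := by
  have h : MDifferentiableAt 𝓘(ℂ, E) 𝓘(ℂ, E) (fun h : G => g * h * g⁻¹) 1 :=
    (contMDiff_conj g).contMDiffAt.mdifferentiableAt (by simp)
  have h1 : g * 1 * g⁻¹ = 1 := by simp
  simp only [Ad, mfderiv, h, writtenInExtChartAt]
  rw [h1]
  simp [Function.comp_def]
  rfl

theorem contDiffAt_chartConj (g : G) : ContDiffAt ℂ ω (chartConj E g) (baseOne E G) := by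
  rw [← contMDiffAt_iff_contDiffAt]
  have h2 := (contMDiff_conj g).contMDiffAt.comp (baseOne E G) (contMDiffAt_chartOne_symm E G)
  refine ContMDiffAt.comp_of_eq (g := chartOne E G) (contMDiffAt_chartOne E G) h2 ?_
  rw [chartOne_symm_baseOne, mul_one, mul_inv_cancel]

theorem contMDiffAt_fst_snd :
    ContMDiffAt 𝓘(ℂ, E × E) 𝓘(ℂ, E) ω (fun p : E × E => (chartOne E G).symm p.1) (baseOne E G, baseOne E G) ∧
    ContMDiffAt 𝓘(ℂ, E × E) 𝓘(ℂ, E) ω (fun p : E × E => (chartOne E G).symm p.2) (baseOne E G, baseOne E G) :=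
  ⟨ContMDiffAt.comp (baseOne E G, baseOne E G) (f := fun p : E × E => p.1)
    (contMDiffAt_chartOne_symm E G) contDiff_fst.contMDiff.contMDiffAt,
   ContMDiffAt.comp (baseOne E G, baseOne E G) (f := fun p : E × E => p.2)
    (contMDiffAt_chartOne_symm E G) contDiff_snd.contMDiff.contMDiffAt⟩

variable (E G) in
theorem contDiffAt_chartMul :
    ContDiffAt ℂ ω (chartMul E G) (baseOne E G, baseOne E G) := by
  rw [← contMDiffAt_iff_contDiffAt]
  obtain ⟨h1, h2⟩ := contMDiffAt_fst_snd (E := E) (G := G)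
  refine ContMDiffAt.comp_of_eq (g := chartOne E G) (contMDiffAt_chartOne E G) (h1.mul h2) ?_
  simp only [chartOne_symm_baseOne, mul_one]

variable (E G) in
theorem contDiffAt_chartConj_uncurry :
    ContDiffAt ℂ ω (fun p : E × E => chartConj E ((chartOne E G).symm p.1) p.2)
      (baseOne E G, baseOne E G) := by
  rw [← contMDiffAt_iff_contDiffAt]
  obtain ⟨h1, h2⟩ := contMDiffAt_fst_snd (E := E) (G := G)
  refine ContMDiffAt.comp_of_eq (g := chartOne E G) (contMDiffAt_chartOne E G)
    ((h1.mul h2).mul h1.inv) ?_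
  simp only [chartOne_symm_baseOne, mul_one, inv_one]

theorem AdL_mul (g h : G) : AdL (E := E) (g * h) = (AdL g).comp (AdL h) := by
  have h1 : HasFDerivAt (chartConj E g) (AdL g) (chartConj E h (baseOne E G)) := by
    rw [chartConj_baseOne]
    exact ((contDiffAt_chartConj g).differentiableAt (by simp)).hasFDerivAt
  have h2 : HasFDerivAt (chartConj E h) (AdL h) (baseOne E G) :=
    ((contDiffAt_chartConj h).differentiableAt (by simp)).hasFDerivAt
  refine ((h1.comp _ h2).congr_of_eventuallyEq ?_).fderiv
  have hcont : Tendsto (fun b => h * (chartOne E G).symm b * h⁻¹) (𝓝 (baseOne E G)) (𝓝 1) := by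
    have := ((contMDiff_conj h).contMDiffAt.comp (baseOne E G)
      (contMDiffAt_chartOne_symm E G)).continuousAt.tendsto
    rwa [Function.comp_apply, chartOne_symm_baseOne, mul_one, mul_inv_cancel] at this
  filter_upwards [hcont.eventually (extChartAt_source_mem_nhds (I := 𝓘(ℂ, E)) (1 : G))] with b hb
  simp only [Function.comp, chartConj]
  rw [(chartOne E G).left_inv hb]
  group

theorem Ad_eq (g : G) (y : LieAlg E G) : Ad g y = AdL (E := E) g y := Ad_eq_fderiv g y

theorem Ad_mul (g h : G) (y : LieAlg E G) : Ad (g * h) y = Ad g (Ad h y) := by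
  have e : Ad h y = (AdL (E := E) h y : E) := Ad_eq h y
  refine (Ad_eq (g * h) y).trans (.trans ?_ (Ad_eq g (Ad h y)).symm)
  rw [AdL_mul]
  exact congrArg (fun w : E => AdL (E := E) g w) e.symm

theorem mfderiv_chartOne_mulInvariantVectorField {g : G}
    (hg : g ∈ (chartAt E (1 : G)).source) (w : LieAlg E G) :
    (mfderiv 𝓘(ℂ, E) 𝓘(ℂ, E) (chartOne E G) g : E →L[ℂ] E) (mulInvariantVectorField w g : E) =
      fderiv ℂ (fun b => chartOne E G (g * (chartOne E G).symm b)) (baseOne E G) w := by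
  have hl : MDifferentiableAt 𝓘(ℂ, E) 𝓘(ℂ, E) (fun h : G => g * h) 1 :=
    (contMDiff_mul_left (n := ω)).contMDiffAt.mdifferentiableAt (by simp)
  have hφ : MDifferentiableAt 𝓘(ℂ, E) 𝓘(ℂ, E) (chartOne E G) (g * 1) := by
    rw [mul_one]
    exact (contMDiffAt_extChartAt' (n := ω) hg).mdifferentiableAt (by simp)
  have hc := hφ.hasMFDerivAt.comp (1 : G) hl.hasMFDerivAt
  have h1 := mfderiv_one_eq hc.mdifferentiableAt
  rw [hc.mfderiv] at h1
  have h2 := congrArg (fun f : E →L[ℂ] E => f w) h1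
  -- The chain rule lands at `g * 1`, whose tangent space is indexed differently from that at `g`;
  -- generalizing the base point allows transport.
  have key : ∀ g', g' = g * 1 → (mfderiv 𝓘(ℂ, E) 𝓘(ℂ, E) (chartOne E G) g' : E →L[ℂ] E)
      (mulInvariantVectorField w g : E) =
      fderiv ℂ (fun b => chartOne E G (g * (chartOne E G).symm b)) (baseOne E G) w := by
    rintro g' rfl
    exact h2
  exact key g (mul_one g).symm

/-- This identifies the fields whose bracket defines the Lie algebra with their coordinate model,
for points near the identity. -/
theorem mpullbackWithin_mulInvariantVectorField (w : LieAlg E G) :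
    VectorField.mpullbackWithin 𝓘(ℂ, E) 𝓘(ℂ, E) (chartOne E G).symm
      (mulInvariantVectorField w) (Set.range 𝓘(ℂ, E)) =ᶠ[𝓝 (baseOne E G)]
      localLeftField (chartMul E G) (baseOne E G) w := by
  have hl : Tendsto (fun a : E => (a, baseOne E G)) (𝓝 (baseOne E G))
      (𝓝 (baseOne E G, baseOne E G)) := (continuous_id.prodMk continuous_const).tendsto _
  filter_upwards [eventually_mem_target E G,
    hl.eventually ((contDiffAt_chartMul E G).eventually (by simp))] with a ha hm
  have hsrc : (chartOne E G).symm a ∈ (chartAt E (1 : G)).source := by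
    rw [← extChartAt_source 𝓘(ℂ, E)]
    exact (chartOne E G).map_target ha
  have h1 := mfderiv_chartOne_mulInvariantVectorField hsrc w
  have hfd : HasFDerivAt (fun b => chartOne E G ((chartOne E G).symm a * (chartOne E G).symm b))
      ((fderiv ℂ (chartMul E G) (a, baseOne E G)).comp (ContinuousLinearMap.inr ℂ E E))
      (baseOne E G) :=
    HasFDerivAt.comp (baseOne E G) (f := fun b : E => (a, b))
      (hm.differentiableAt (by simp)).hasFDerivAt (hasFDerivAt_prodMk_right _ _)
  rw [hfd.fderiv] at h1
  have h2 : localLeftField (chartMul E G) (baseOne E G) w a =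
    (mfderiv 𝓘(ℂ, E) 𝓘(ℂ, E) (chartOne E G) ((chartOne E G).symm a) : E →L[ℂ] E)
      (mulInvariantVectorField w ((chartOne E G).symm a) : E) := by
    rw [h1]; rfl
  rw [h2, VectorField.mpullbackWithin_apply]
  have hinv := isInvertible_mfderivWithin_extChartAt_symm (I := 𝓘(ℂ, E)) ha
  refine (hinv.inverse_apply_eq).2 ?_
  have h3 := mfderivWithin_extChartAt_symm_comp_mfderiv_extChartAt (I := 𝓘(ℂ, E)) (x := (1 : G)) ha
  exact (congrArg (fun f : E →L[ℂ] E =>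
    f (mulInvariantVectorField w ((chartOne E G).symm a) : E)) h3).symm

theorem localLeftField_baseOne (w : E) :
    localLeftField (chartMul E G) (baseOne E G) w (baseOne E G) = w := by
  have h : HasFDerivAt (fun b => chartMul E G (baseOne E G, b)) _ (baseOne E G) :=
    HasFDerivAt.comp (baseOne E G) (f := fun b : E => (baseOne E G, b))
      ((contDiffAt_chartMul E G).differentiableAt (by simp)).hasFDerivAt
      (hasFDerivAt_prodMk_right _ _)
  have := (h.congr_of_eventuallyEq
    ((eventually_chartMul_left E G).mono fun _ h => h.symm)).unique (hasFDerivAt_id _)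
  simpa [localLeftField] using congrArg (fun f : E →L[ℂ] E => f w) this

theorem eventually_AdL_eq (y : E) :
    (fun a => AdL ((chartOne E G).symm a) y) =ᶠ[𝓝 (baseOne E G)] fun a =>
      fderiv ℂ (fun p : E × E => chartConj E ((chartOne E G).symm p.1) p.2)
        (a, baseOne E G) (0, y) := by
  have hl : Tendsto (fun a : E => (a, baseOne E G)) (𝓝 (baseOne E G))
      (𝓝 (baseOne E G, baseOne E G)) := (continuous_id.prodMk continuous_const).tendsto _
  filter_upwards [hl.eventually ((contDiffAt_chartConj_uncurry E G).eventually (by simp))] with a ha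
  have : HasFDerivAt (fun b => chartConj E ((chartOne E G).symm a) b) _ (baseOne E G) :=
    HasFDerivAt.comp (baseOne E G) (f := fun b : E => (a, b))
      (ha.differentiableAt (by simp)).hasFDerivAt (hasFDerivAt_prodMk_right _ _)
  rw [AdL, this.fderiv]
  rfl

theorem contDiffAt_AdL (y : E) :
    ContDiffAt ℂ ω (fun a => AdL ((chartOne E G).symm a) y) (baseOne E G) :=
  (contDiffAt_localLeftField (contDiffAt_chartConj_uncurry E G) y).congr_of_eventuallyEq
    (eventually_AdL_eq y)

theorem lie_eq (v w : LieAlg E G) :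
    (⁅v, w⁆ : LieAlg E G) =
      (fderiv ℂ (localLeftField (chartMul E G) (baseOne E G) w) (baseOne E G) v -
        fderiv ℂ (localLeftField (chartMul E G) (baseOne E G) v) (baseOne E G) w : E) := by
  have h : (mfderiv 𝓘(ℂ, E) 𝓘(ℂ, E) (chartOne E G) 1 : E →L[ℂ] E) =
    ContinuousLinearMap.id ℂ E := mfderiv_extChartAt_self
  have hv := mpullbackWithin_mulInvariantVectorField (E := E) (G := G) v
  have hw := mpullbackWithin_mulInvariantVectorField (E := E) (G := G) w
  have hset : (chartOne E G).symm ⁻¹' univ ∩ range 𝓘(ℂ, E) = univ := by simp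
  let X : LieAlg E G → E → E := fun u => VectorField.mpullbackWithin 𝓘(ℂ, E) 𝓘(ℂ, E)
    (chartOne E G).symm (mulInvariantVectorField u) (range 𝓘(ℂ, E))
  change X v =ᶠ[_] _ at hv
  change X w =ᶠ[_] _ at hw
  -- The differential of the preferred chart at its own centre is the identity, so pulling the
  -- bracket back to the group changes nothing.
  have hinv : ∀ (f : E →L[ℂ] E) (z : E), f = ContinuousLinearMap.id ℂ E → f.inverse z = z := by
    rintro _ z rfl
    rw [ContinuousLinearMap.inverse_id]
    rfl
  refine (hinv _ (VectorField.lieBracketWithin ℂ (X v) (X w)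
    ((chartOne E G).symm ⁻¹' univ ∩ range 𝓘(ℂ, E)) (baseOne E G)) h).trans ?_
  rw [hset, VectorField.lieBracketWithin_univ,
    hv.lieBracket_vectorField_eq hw, VectorField.lieBracket_eq]
  have hcongr : ∀ (A B : E →L[ℂ] E) {a a' b b' : E}, a = a' → b = b' → A a - B b = A a' - B b' := by
    rintro A B a _ b _ rfl rfl
    rfl
  exact hcongr _ _ (localLeftField_baseOne (E := E) (G := G) v) (localLeftField_baseOne (E := E) (G := G) w)

/-- The differential of `Ad` is `ad`: `(a b a⁻¹) a = a b` in coordinates is the relation `hmK`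
required by `hasFDerivAt_local_conj`. -/
theorem hasFDerivAt_AdL (y : E) : ∃ F' : E →L[ℂ] E,
    HasFDerivAt (fun a => AdL ((chartOne E G).symm a) y) F' (baseOne E G) ∧
      ∀ v : LieAlg E G, F' v = (⁅v, (y : LieAlg E G)⁆ : LieAlg E G) := by
  have hK := contDiffAt_chartConj_uncurry E G
  obtain ⟨h1, h2⟩ := contMDiffAt_fst_snd (E := E) (G := G)
  have hsrc : (chartOne E G).source ∈ 𝓝 (1 : G) :=
    extChartAt_source_mem_nhds (I := 𝓘(ℂ, E)) (1 : G)
  have hmul : ∀ᶠ p in 𝓝 (baseOne E G, baseOne E G),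
      (chartOne E G).symm p.1 * (chartOne E G).symm p.2 * ((chartOne E G).symm p.1)⁻¹ ∈
        (chartOne E G).source := by
    have := ((h1.mul h2).mul h1.inv).continuousAt.tendsto
    refine this.eventually ?_
    simp only [Pi.mul_apply, chartOne_symm_baseOne, mul_one, inv_one]
    exact hsrc
  have hKl : ∀ᶠ b in 𝓝 (baseOne E G),
      chartConj E ((chartOne E G).symm (baseOne E G)) b = b := by
    filter_upwards [eventually_mem_target E G] with b hb
    simp only [chartConj, chartOne_symm_baseOne, one_mul, inv_one, mul_one]
    exact (chartOne E G).right_inv hb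
  have hmK : ∀ᶠ p in 𝓝 (baseOne E G, baseOne E G),
      chartMul E G (chartConj E ((chartOne E G).symm p.1) p.2, p.1) = chartMul E G p := by
    filter_upwards [hmul] with p hp
    simp only [chartMul, chartConj]
    rw [(chartOne E G).left_inv hp, inv_mul_cancel_right]
  obtain ⟨F', hF', h⟩ := hasFDerivAt_local_conj (contDiffAt_chartMul E G) hK
    (eventually_chartMul_right E G) hKl (Eventually.of_forall fun a => chartConj_baseOne _) hmK y
  exact ⟨F', hF'.congr_of_eventuallyEq (eventually_AdL_eq y),
    fun v => (h v).trans (lie_eq v y).symm⟩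

end LieGroup

/-! ### Holomorphic functions on a complex Lie group -/

section Holomorphic

open Filter Topology Set

variable {E : Type*} [NormedAddCommGroup E] [NormedSpace ℂ E]

/-- The identity theorem, for products: if the product of two holomorphic functions on a connected
complex manifold vanishes, then so does one of the functions. -/
theorem eq_zero_or_eq_zero_of_mul_eq_zero {X : Type*} [TopologicalSpace X] [ChartedSpace E X]
    [IsManifold 𝓘(ℂ, E) ω X] [PreconnectedSpace X] {u v : X → ℂ}
    (hu : ContMDiff 𝓘(ℂ, E) 𝓘(ℂ, ℂ) ω u) (hv : ContMDiff 𝓘(ℂ, E) 𝓘(ℂ, ℂ) ω v)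
    (huv : ∀ p, u p * v p = 0) : u = 0 ∨ v = 0 := by
  by_contra! h
  obtain ⟨h1, h2⟩ := h
  obtain ⟨p, hp⟩ := Function.ne_iff.1 h1
  have hvp : ∀ᶠ q in 𝓝 p, v q = 0 := by
    filter_upwards [hu.continuous.continuousAt.eventually_ne hp] with q hq
    exact (mul_eq_zero.1 (huv q)).resolve_left hq
  -- The points near which `v` vanishes form an open set; it is closed by the identity theorem for
  -- analytic functions on a coordinate ball.
  have hopen : IsOpen {q | ∀ᶠ r in 𝓝 q, v r = 0} := isOpen_setOfPred_eventually_nhds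
  have hclosed : IsClosed {q | ∀ᶠ r in 𝓝 q, v r = 0} := by
    rw [← closure_subset_iff_isClosed]
    intro q hq
    let φ := extChartAt 𝓘(ℂ, E) q
    obtain ⟨ε, hε, hB⟩ := Metric.mem_nhds_iff.1 (extChartAt_target_mem_nhds (I := 𝓘(ℂ, E)) q)
    have hφ : Tendsto φ (𝓝 q) (𝓝 (φ q)) := continuousAt_extChartAt (I := 𝓘(ℂ, E)) q
    have hN : ∀ᶠ r in 𝓝 q, r ∈ φ.source ∧ φ r ∈ Metric.ball (φ q) ε :=
      Filter.Eventually.and (extChartAt_source_mem_nhds (I := 𝓘(ℂ, E)) q)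
        (hφ.eventually (Metric.ball_mem_nhds _ hε))
    have han : AnalyticOnNhd ℂ (fun b => v (φ.symm b)) (Metric.ball (φ q) ε) := by
      intro b hb
      refine ContDiffAt.analyticAt ?_
      rw [← contMDiffAt_iff_contDiffAt]
      exact hv.contMDiffAt.comp b ((contMDiffOn_extChartAt_symm (I := 𝓘(ℂ, E)) (n := ω) q).contMDiffAt
        (mem_of_superset (Metric.isOpen_ball.mem_nhds hb) hB))
    obtain ⟨r, hr, hrv⟩ := mem_closure_iff_nhds.1 hq _ hN
    have hr0 : (fun b => v (φ.symm b)) =ᶠ[𝓝 (φ r)] 0 := by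
      have hc : Tendsto φ.symm (𝓝 (φ r)) (𝓝 r) := by
        have := continuousAt_extChartAt_symm' (I := 𝓘(ℂ, E)) (x := q) hr.1
        rw [ContinuousAt, φ.left_inv hr.1] at this
        exact this
      exact hc.eventually hrv
    have hz := han.eqOn_zero_of_preconnected_of_eventuallyEq_zero
      (convex_ball (φ q) ε).isPreconnected hr.2 hr0
    filter_upwards [hN] with s hs
    have := hz hs.2
    simpa [φ.left_inv hs.1] using this
  have huniv := IsClopen.eq_univ ⟨hclosed, hopen⟩ ⟨p, hvp⟩
  refine h2 (funext fun q => ?_)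
  have : q ∈ {q | ∀ᶠ r in 𝓝 q, v r = 0} := huniv ▸ mem_univ q
  exact this.self_of_nhds

variable {G : Type*} [TopologicalSpace G] [ChartedSpace E G] [Group G]

theorem derivAtOne_eq_fderiv {u : G → ℂ} (hu : MDifferentiableAt 𝓘(ℂ, E) 𝓘(ℂ, ℂ) u 1)
    (x : LieAlg E G) :
    derivAtOne u x = fderiv ℂ (fun b => u ((chartOne E G).symm b)) (baseOne E G) x :=
  congrArg (fun f : E →L[ℂ] ℂ => f x) (mfderiv_one_eq hu)

variable [LieGroup 𝓘(ℂ, E) ω G]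

/-- A holomorphic function on a connected Lie group is constant if all its right translates have
vanishing differential at `1`. -/
theorem eq_const_of_derivAtOne_eq_zero [PreconnectedSpace G] {u : G → ℂ}
    (hu : ContMDiff 𝓘(ℂ, E) 𝓘(ℂ, ℂ) ω u)
    (h : ∀ (g : G) (x : LieAlg E G), derivAtOne (fun k => u (k * g)) x = 0) (g : G) :
    u g = u 1 := by
  refine IsLocallyConstant.apply_eq_of_preconnectedSpace
    ((IsLocallyConstant.iff_eventually_eq u).2 fun q => ?_) g 1
  let φ := extChartAt 𝓘(ℂ, E) q
  obtain ⟨ε, hε, hB⟩ := Metric.mem_nhds_iff.1 (extChartAt_target_mem_nhds (I := 𝓘(ℂ, E)) q)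
  have hder : ∀ b ∈ Metric.ball (φ q) ε, HasFDerivAt (fun b => u (φ.symm b)) (0 : E →L[ℂ] ℂ) b := by
    intro b hb
    -- Right translation by `k` moves the point `φ.symm b` to `1`, where the hypothesis applies.
    let k := φ.symm b
    have hφ : MDifferentiableAt 𝓘(ℂ, E) 𝓘(ℂ, E) (fun b' => φ.symm b' * k⁻¹) b :=
      (((contMDiffOn_extChartAt_symm (I := 𝓘(ℂ, E)) (n := ω) q).contMDiffAt
        (mem_of_superset (Metric.isOpen_ball.mem_nhds hb) hB)).mul
        contMDiffAt_const).mdifferentiableAt (by simp)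
    have hv : MDifferentiableAt 𝓘(ℂ, E) 𝓘(ℂ, ℂ) (fun l => u (l * k)) 1 :=
      (hu.comp (contMDiff_mul_right (n := ω))).contMDiffAt.mdifferentiableAt (by simp)
    have hv0 : HasMFDerivAt 𝓘(ℂ, E) 𝓘(ℂ, ℂ) (fun l => u (l * k)) (φ.symm b * k⁻¹) 0 := by
      have e : φ.symm b * k⁻¹ = 1 := mul_inv_cancel _
      rw [e]
      have := hv.hasMFDerivAt
      have h0 : mfderiv 𝓘(ℂ, E) 𝓘(ℂ, ℂ) (fun l => u (l * k)) 1 = 0 :=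
        ContinuousLinearMap.ext fun x => h k x
      rwa [h0] at this
    have hc := hv0.comp b hφ.hasMFDerivAt
    rw [ContinuousLinearMap.zero_comp] at hc
    have hc' := hc.hasFDerivAt
    have : ((fun l => u (l * k)) ∘ fun b' => φ.symm b' * k⁻¹) = fun b => u (φ.symm b) := by
      funext b'
      simp
    rwa [this] at hc'
  have hφ : Tendsto φ (𝓝 q) (𝓝 (φ q)) := continuousAt_extChartAt (I := 𝓘(ℂ, E)) q
  filter_upwards [extChartAt_source_mem_nhds (I := 𝓘(ℂ, E)) q,
    hφ.eventually (Metric.ball_mem_nhds _ hε)] with r hr hr'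
  have := Metric.isOpen_ball.is_const_of_fderiv_eq_zero (𝕜 := ℂ)
    (convex_ball (φ q) ε).isPreconnected
    (fun b hb => (hder b hb).differentiableAt.differentiableWithinAt)
    (fun b hb => (hder b hb).fderiv) hr' (Metric.mem_ball_self hε)
  rwa [φ.left_inv hr, φ.left_inv (mem_extChartAt_source (I := 𝓘(ℂ, E)) q)] at this

theorem derivAtOne_Ad (l : LieAlg E G →ₗ[ℂ] ℂ) [FiniteDimensional ℂ E] (x y : LieAlg E G) :
    derivAtOne (fun g : G => l (Ad g y)) x = l ⁅x, y⁆ := by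
  obtain ⟨F', hF', h⟩ := hasFDerivAt_AdL (E := E) (G := G) y
  let l' : E →ₗ[ℂ] ℂ := l
  let L : E →L[ℂ] ℂ := LinearMap.toContinuousLinearMap l'
  have hL : HasFDerivAt (fun a => L (AdL ((chartOne E G).symm a) y)) (L.comp F') (baseOne E G) :=
    L.hasFDerivAt.comp _ hF'
  have hsrc : (chartOne E G).source ∈ 𝓝 (1 : G) :=
    extChartAt_source_mem_nhds (I := 𝓘(ℂ, E)) (1 : G)
  have hu : MDifferentiableAt 𝓘(ℂ, E) 𝓘(ℂ, ℂ) (fun g : G => l (Ad g y)) 1 := by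
    have h1 : MDifferentiableAt 𝓘(ℂ, E) 𝓘(ℂ, ℂ)
        ((fun a => L (AdL ((chartOne E G).symm a) y)) ∘ chartOne E G) 1 :=
      MDifferentiableAt.comp (1 : G) hL.differentiableAt.mdifferentiableAt
        ((contMDiffAt_chartOne E G).mdifferentiableAt (by simp))
    refine h1.congr_of_eventuallyEq ?_
    filter_upwards [hsrc] with g hg
    rw [Function.comp_apply, (chartOne E G).left_inv hg, Ad_eq]
    rfl
  rw [derivAtOne_eq_fderiv hu]
  have : (fun b => l (Ad ((chartOne E G).symm b) y)) =
      fun a => L (AdL ((chartOne E G).symm a) y) := by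
    funext b
    rw [Ad_eq]
    rfl
  rw [this, hL.fderiv]
  exact congrArg l (h x)

variable [CompleteSpace E]

/-- If `x` centralizes `y`, then any holomorphic function on the group that is constant along
curves in the stabilizer of `y` has vanishing derivative at `1` in the direction `x`. -/
theorem derivAtOne_eq_zero_of_lie_eq_zero {x y : LieAlg E G} (hxy : ⁅x, y⁆ = 0) {u : G → ℂ}
    (hu : MDifferentiableAt 𝓘(ℂ, E) 𝓘(ℂ, ℂ) u 1)
    (h : ∀ (γ : ℝ → G) (δ : ℝ), 0 < δ → γ 0 = 1 → ContinuousOn γ (Ioo (-δ) δ) →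
      (∀ t ∈ Ioo (-δ) δ, Ad (γ t) y = y) → ∀ t ∈ Ioo (-δ) δ, u (γ t) = u 1) :
    derivAtOne u x = 0 := by
  have hX := contDiffAt_localLeftField (contDiffAt_chartMul E G) x
  -- A real-time integral curve, through the identity, of the left-invariant field of `x`; it plays
  -- the part of `t ↦ exp (t x)`.
  obtain ⟨c, hc0, ε, hε, hc⟩ :=
    ((hX.restrict_scalars ℝ).of_le
      (le_top : (1 : WithTop ℕ∞) ≤ ω)).exists_forall_mem_closedBall_exists_eq_forall_mem_Ioo_hasDerivAt₀ 0
  let p : E → E := fun a => AdL ((chartOne E G).symm a) y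
  have hl : Tendsto (fun a : E => (a, baseOne E G)) (𝓝 (baseOne E G))
      (𝓝 (baseOne E G, baseOne E G)) := (continuous_id.prodMk continuous_const).tendsto _
  -- From `Ad (a b) y = Ad a (Ad b y)`, the derivative of `p` along the left-invariant field is `Ad
  -- a [x, y] = 0`. Hence `p` is constant along `c`, which stays in the stabilizer of `y`.
  have hp : ∀ᶠ a in 𝓝 (baseOne E G), HasFDerivAt p (fderiv ℂ p a) a ∧
      fderiv ℂ p a (localLeftField (chartMul E G) (baseOne E G) x a) = 0 := by
    have hmul : ∀ᶠ q in 𝓝 (baseOne E G, baseOne E G),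
        (chartOne E G).symm q.1 * (chartOne E G).symm q.2 ∈ (chartOne E G).source := by
      obtain ⟨h1, h2⟩ := contMDiffAt_fst_snd (E := E) (G := G)
      refine (h1.mul h2).continuousAt.tendsto.eventually ?_
      simp only [Pi.mul_apply, chartOne_symm_baseOne, mul_one]
      exact extChartAt_source_mem_nhds (I := 𝓘(ℂ, E)) (1 : G)
    obtain ⟨F', hF', hF⟩ := hasFDerivAt_AdL (E := E) (G := G) y
    filter_upwards [(contDiffAt_AdL (G := G) (E := E) y).eventually (by simp),
      hl.eventually ((contDiffAt_chartMul E G).eventually (by simp)),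
      (nhds_prod_eq (x := baseOne E G) (y := baseOne E G) ▸ hmul).curry,
      eventually_chartMul_right E G] with a h1 h2 h3 h4
    have hpa : HasFDerivAt p (fderiv ℂ p a) a := (h1.differentiableAt (by simp)).hasFDerivAt
    refine ⟨hpa, ?_⟩
    rw [← h4] at hpa
    have hin : HasFDerivAt (fun b => chartMul E G (a, b)) _ (baseOne E G) :=
      HasFDerivAt.comp (baseOne E G) (f := fun b : E => (a, b))
        (h2.differentiableAt (by simp)).hasFDerivAt (hasFDerivAt_prodMk_right _ _)
    have hA : HasFDerivAt (fun b => p (chartMul E G (a, b))) _ (baseOne E G) :=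
      HasFDerivAt.comp (baseOne E G) (f := fun b => chartMul E G (a, b)) hpa hin
    have hB : HasFDerivAt (fun b => AdL ((chartOne E G).symm a) (p b)) _ (baseOne E G) :=
      (AdL ((chartOne E G).symm a)).hasFDerivAt.comp _ hF'
    have hAB : (fun b => p (chartMul E G (a, b))) =ᶠ[𝓝 (baseOne E G)]
        fun b => AdL ((chartOne E G).symm a) (p b) := by
      filter_upwards [h3] with b hb
      simp only [p, chartMul]
      rw [(chartOne E G).left_inv hb, AdL_mul]
      rfl
    have h5 := congrArg (fun f : E →L[ℂ] E => f x)
      (hA.unique (hB.congr_of_eventuallyEq hAB))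
    have h6 : F' x = 0 := (hF x).trans hxy
    have h7 : (AdL ((chartOne E G).symm a)) (F' x) = 0 := by rw [h6, map_zero]
    rw [h4] at h5
    exact h5.trans h7
  have hgood := hp.and (eventually_mem_target E G)
  obtain ⟨N, hN, hNo, h0N⟩ := eventually_nhds_iff.1 hgood
  have hcont : ContinuousAt c 0 := (hc 0 (by constructor <;> linarith)).continuousAt
  obtain ⟨δ₀, hδ₀, hδN⟩ := Metric.eventually_nhds_iff.1
    (hcont.eventually (hNo.mem_nhds (hc0.symm ▸ h0N)))
  let δ := min δ₀ ε
  have hδ : 0 < δ := lt_min hδ₀ hε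
  have hcN : ∀ t ∈ Ioo (-δ) δ, c t ∈ N := fun t ht => hδN (by
    rw [Real.dist_eq, sub_zero]
    exact (abs_lt.2 ht).trans_le (min_le_left _ _))
  have hcd : ∀ t ∈ Ioo (-δ) δ,
      HasDerivAt c (localLeftField (chartMul E G) (baseOne E G) x (c t)) t := fun t ht => by
    refine hc t ⟨?_, ?_⟩
    · have := min_le_right δ₀ ε
      have := ht.1
      grind
    · have := min_le_right δ₀ ε
      have := ht.2
      grind
  have h0δ : (0 : ℝ) ∈ Ioo (-δ) δ := ⟨neg_lt_zero.2 hδ, hδ⟩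
  have hpd : ∀ t ∈ Ioo (-δ) δ, HasDerivAt (fun t => p (c t)) 0 t := by
    intro t ht
    have h1 := ((hN _ (hcN t ht)).1.1.restrictScalars ℝ).comp_hasDerivAt t (hcd t ht)
    have h2 := (hN _ (hcN t ht)).1.2
    rwa [ContinuousLinearMap.coe_restrictScalars', h2] at h1
  have hstab : ∀ t ∈ Ioo (-δ) δ, Ad ((chartOne E G).symm (c t)) y = y := by
    intro t ht
    have h1 : p (c t) = p (c 0) := isOpen_Ioo.is_const_of_deriv_eq_zero isPreconnected_Ioo
      (fun s hs => (hpd s hs).differentiableAt.differentiableWithinAt)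
      (fun s hs => (hpd s hs).deriv) ht h0δ
    rw [Ad_eq]
    refine h1.trans ?_
    simp only [p, hc0, chartOne_symm_baseOne, AdL_one]
    rfl
  have hγ := h (fun t => (chartOne E G).symm (c t)) δ hδ
    (by simp only [hc0, chartOne_symm_baseOne])
    ((continuousOn_extChartAt_symm (I := 𝓘(ℂ, E)) (1 : G)).comp
      (fun t ht => (hcd t ht).continuousAt.continuousWithinAt) fun t ht => (hN _ (hcN t ht)).2)
    hstab
  have hud : DifferentiableAt ℂ (fun b => u ((chartOne E G).symm b)) (baseOne E G) := by
    have h1 := hu.comp_of_eq (baseOne E G) ((contMDiffAt_chartOne_symm E G).mdifferentiableAt (by simp))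
      (chartOne_symm_baseOne E G)
    exact h1.differentiableAt
  have hd1 : HasDerivAt (fun t => u ((chartOne E G).symm (c t)))
      (fderiv ℂ (fun b => u ((chartOne E G).symm b)) (baseOne E G) x) 0 := by
    have h1 := hud.hasFDerivAt
    have h2 := hcd 0 h0δ
    rw [← hc0] at h1
    have h3 := (h1.restrictScalars ℝ).comp_hasDerivAt 0 h2
    rw [hc0] at h3
    exact h3.congr_deriv (congrArg (fun w : E =>
      fderiv ℂ (fun b => u ((chartOne E G).symm b)) (baseOne E G) w)
      (localLeftField_baseOne (E := E) (G := G) x))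
  have hd2 : HasDerivAt (fun t => u ((chartOne E G).symm (c t))) 0 0 :=
    (hasDerivAt_const (0 : ℝ) (u 1)).congr_of_eventuallyEq
      (Filter.eventually_of_mem (Ioo_mem_nhds h0δ.1 h0δ.2) hγ)
  rw [derivAtOne_eq_fderiv hu]
  exact hd1.unique hd2

end Holomorphic

/-! ### Covers of orbits -/

namespace OrbitCover

open Filter Topology Set

variable {E : Type*} [NormedAddCommGroup E] [NormedSpace ℂ E]
  {G : Type*} [TopologicalSpace G] [ChartedSpace E G] [Group G]
  {e : LieAlg E G} {M : Type*} [TopologicalSpace M] (C : OrbitCover e M)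

theorem act_mul (g h : G) (m : M) : C.act (g * h) m = C.act g (C.act h m) := by
  rw [map_mul]
  rfl

theorem act_one (m : M) : C.act 1 m = m := by
  rw [map_one]
  rfl

theorem continuous_orbit (m : M) : Continuous fun g : G => C.act g m :=
  C.continuous_act.comp (continuous_id.prodMk continuous_const)

/-- The group of deck transformations of a connected finite cover is finite. -/
theorem finite_deckGroup [ConnectedSpace M] : Finite C.deckGroup := by
  obtain ⟨m₀⟩ : Nonempty M := inferInstance
  have : Finite (C.κ ⁻¹' {C.κ m₀}) := C.finite_fiber _
  refine Finite.of_injective (fun s : C.deckGroup =>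
    (⟨s.1 m₀, s.2 m₀⟩ : C.κ ⁻¹' {C.κ m₀})) fun s t hst => ?_
  have h : (s.1 : M → M) = t.1 := C.isCoveringMap.eq_of_comp_eq s.1.continuous t.1.continuous
    (funext fun m => (s.2 m).trans (t.2 m).symm) m₀ (congrArg Subtype.val hst)
  exact Subtype.ext (DFunLike.coe_injective h)

variable [LieGroup 𝓘(ℂ, E) ω G]

/-- The orbit has the quotient topology, so openness is tested in the group: if `Ad k e` is reached
by `w ∈ W`, then `Ad k' e` is reached by `k' k⁻¹ w`, which is in `W` for `k'` near `k`. -/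
theorem isOpen_image_κ_act (m : M) {W : Set G} (hW : IsOpen W) :
    IsOpen ((fun g => C.κ (C.act g m)) '' W) := by
  have := topologicalGroup_of_lieGroup 𝓘(ℂ, E) ω (G := G)
  obtain ⟨g₀, hg₀⟩ := (C.κ m).2
  have hq : ∀ g, (C.κ (C.act g m)).val = Ad (g * g₀) e := by
    intro g
    have h₀ : (C.κ m).val = Ad g₀ e := hg₀.symm
    rw [C.κ_act, h₀, Ad_mul]
  change IsOpen (orbitMap e ⁻¹' _)
  rw [isOpen_iff_mem_nhds]
  rintro k ⟨w, hw, hkw⟩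
  have hcont : Continuous fun k' : G => k' * k⁻¹ * w :=
    (continuous_id.mul continuous_const).mul continuous_const
  have hmem : ∀ᶠ k' in 𝓝 k, k' * k⁻¹ * w ∈ W :=
    hcont.continuousAt.eventually (hW.mem_nhds (by simpa using hw))
  filter_upwards [hmem] with k' hk'
  refine ⟨_, hk', Subtype.ext ?_⟩
  have h1 : Ad (w * g₀) e = Ad k e := (hq w).symm.trans (congrArg Orbit.val hkw)
  refine (hq _).trans ?_
  change _ = Ad k' e
  rw [mul_assoc, Ad_mul, h1, ← Ad_mul, inv_mul_cancel_right]

/-- Near `m` the covering map is injective, and the group orbit of `m` already fills a neighbourhood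
downstairs. -/
theorem orbit_mem_nhds (m : M) : range (fun g : G => C.act g m) ∈ 𝓝 m := by
  obtain ⟨φ, hm, hφ⟩ := C.isCoveringMap.isLocalHomeomorph m
  let W : Set G := (fun g => C.act g m) ⁻¹' φ.source
  have hW : IsOpen W := φ.open_source.preimage (C.continuous_orbit m)
  have hq := C.isOpen_image_κ_act m hW
  have hV : φ.source ∩ C.κ ⁻¹' ((fun g => C.κ (C.act g m)) '' W) ∈ 𝓝 m := by
    refine inter_mem (φ.open_source.mem_nhds hm)
      ((hq.preimage C.isCoveringMap.continuous).mem_nhds ⟨1, ?_, ?_⟩)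
    · change C.act 1 m ∈ φ.source
      rwa [C.act_one]
    · simp only [C.act_one]
  refine mem_of_superset hV ?_
  rintro m' ⟨hm', w, hw, hκ⟩
  rw [hφ] at hκ
  exact ⟨w, φ.injOn hw hm' hκ⟩

/-- The group acts transitively on a connected cover of an orbit. -/
theorem exists_act_eq [PreconnectedSpace M] (m m' : M) : ∃ g : G, C.act g m = m' := by
  have hopen : IsOpen (range fun g : G => C.act g m) := by
    rw [isOpen_iff_mem_nhds]
    rintro _ ⟨g, rfl⟩
    refine mem_of_superset (C.orbit_mem_nhds _) ?_
    rintro _ ⟨h, rfl⟩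
    exact ⟨h * g, C.act_mul h g m⟩
  have hclosed : IsClosed (range fun g : G => C.act g m) := by
    rw [← isOpen_compl_iff, isOpen_iff_mem_nhds]
    intro m₁ hm₁
    refine mem_of_superset (C.orbit_mem_nhds m₁) ?_
    rintro _ ⟨h, rfl⟩ ⟨g, hg⟩
    refine hm₁ ⟨h⁻¹ * g, ?_⟩
    simp only at hg ⊢
    rw [C.act_mul, hg, ← C.act_mul, inv_mul_cancel, C.act_one]
  have := IsClopen.eq_univ ⟨hclosed, hopen⟩ ⟨_, 1, rfl⟩
  exact (this ▸ mem_univ m' : m' ∈ range fun g : G => C.act g m)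

/-- The algebra of regular functions on a connected cover is a domain. -/
theorem eq_zero_or_eq_zero [ConnectedSpace M] [PreconnectedSpace G] {f h : M → ℂ}
    (hf : C.IsHolomorphic f) (hh : C.IsHolomorphic h) (hfh : f * h = 0) : f = 0 ∨ h = 0 := by
  obtain ⟨m₀⟩ : Nonempty M := inferInstance
  have aux : ∀ u : M → ℂ, (fun g : G => u (C.act g m₀)) = 0 → u = 0 := by
    intro u hu
    funext m
    obtain ⟨g, rfl⟩ := C.exists_act_eq m₀ m
    exact congrFun hu g
  exact (eq_zero_or_eq_zero_of_mul_eq_zero (hf m₀) (hh m₀) fun g => congrFun hfh (C.act g m₀)).imp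
    (aux f) (aux h)

theorem eq_of_derivAtOne_eq_zero [PreconnectedSpace M] [PreconnectedSpace G] {f : M → ℂ}
    (hf : C.IsHolomorphic f)
    (h : ∀ (m : M) (x : LieAlg E G), derivAtOne (fun g : G => f (C.act g m)) x = 0) (m m' : M) :
    f m = f m' := by
  obtain ⟨g, rfl⟩ := C.exists_act_eq m m'
  have := eq_const_of_derivAtOne_eq_zero (hf m) (fun k x => by
    simpa only [C.act_mul] using h (C.act k m) x) g
  simp only [C.act_one] at this
  exact this.symm

/-! ### Differentials on the cover and the Poisson bracket. -/

variable [CompleteSpace E]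

/-- The differential of a holomorphic function at `m` kills the centralizer of `κ m`. -/
theorem derivAtOne_eq_zero_of_lie_eq_zero {f : M → ℂ} (hf : C.IsHolomorphic f) (m : M)
    {x : LieAlg E G} (hx : ⁅x, (C.κ m).val⁆ = 0) :
    derivAtOne (fun g : G => f (C.act g m)) x = 0 := by
  refine Dixmier.derivAtOne_eq_zero_of_lie_eq_zero hx
    ((hf m).contMDiffAt.mdifferentiableAt (by simp)) fun γ δ hδ hγ0 hγ hstab t ht => ?_
  have h0 : (0 : ℝ) ∈ Ioo (-δ) δ := ⟨neg_lt_zero.2 hδ, hδ⟩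
  -- The curve `γ t • m` lies over the single point `κ m`, so by uniqueness of lifts it is constant.
  have := C.isCoveringMap.constOn_of_comp (s := Ioo (-δ) δ) (g := fun t => C.act (γ t) m)
    isPreconnected_Ioo ((C.continuous_orbit m).comp_continuousOn hγ) (fun s hs s' hs' => by
      refine Subtype.ext ?_
      change (C.κ (C.act (γ s) m)).val = (C.κ (C.act (γ s') m)).val
      rw [C.κ_act, C.κ_act, hstab s hs, hstab s' hs']) ht h0
  change f (C.act (γ t) m) = f (C.act 1 m)
  rw [← hγ0]
  exact congrArg f this

theorem isCodifferential_codifferential {f : M → ℂ} {m : M} (h : ∃ z, C.IsCodifferential f m z) :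
    C.IsCodifferential f m (C.codifferential f m) :=
  Classical.epsilon_spec h

variable [FiniteDimensional ℂ E]

instance : FiniteDimensional ℂ (LieAlg E G) := inferInstanceAs (FiniteDimensional ℂ E)

theorem isCodifferential_hamiltonian (x : LieAlg E G) (m : M) :
    C.IsCodifferential (C.hamiltonian x) m x := by
  intro x'
  simp only [hamiltonian, C.κ_act]
  exact derivAtOne_Ad (killingForm ℂ (LieAlg E G) x) x' (C.κ m).val

variable [LieAlgebra.IsSemisimple ℂ (LieAlg E G)]

/-- The differential kills the kernel of `x ↦ [x, κ m]`, so it factors through this map, and the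
Killing form represents the resulting functional. -/
theorem exists_isCodifferential {f : M → ℂ} (hf : C.IsHolomorphic f) (m : M) :
    ∃ z, C.IsCodifferential f m z := by
  let d : LieAlg E G →ₗ[ℂ] ℂ :=
    (mfderiv 𝓘(ℂ, E) 𝓘(ℂ, ℂ) (fun g : G => f (C.act g m)) 1 : E →L[ℂ] ℂ).toLinearMap
  let A : LieAlg E G →ₗ[ℂ] LieAlg E G := -(LieAlgebra.ad ℂ (LieAlg E G) (C.κ m).val)
  have hA : ∀ x, A x = ⁅x, (C.κ m).val⁆ := fun x => by simp [A]
  have hd : d ∈ (LinearMap.ker A).dualAnnihilator := by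
    rw [Submodule.mem_dualAnnihilator]
    intro x hx
    rw [LinearMap.mem_ker, hA] at hx
    exact C.derivAtOne_eq_zero_of_lie_eq_zero hf m hx
  rw [← LinearMap.range_dualMap_eq_dualAnnihilator_ker] at hd
  obtain ⟨d', hd'⟩ := hd
  let B := LinearMap.BilinForm.toDual (killingForm ℂ (LieAlg E G))
    (LieAlgebra.IsKilling.killingForm_nondegenerate ℂ (LieAlg E G))
  refine ⟨B.symm d', fun x => ?_⟩
  have h1 : killingForm ℂ (LieAlg E G) (B.symm d') ⁅x, (C.κ m).val⁆ = d' ⁅x, (C.κ m).val⁆ :=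
    LinearMap.congr_fun (B.apply_symm_apply d') _
  rw [h1, ← hA]
  exact (LinearMap.congr_fun hd' x).symm

/-- The Poisson bracket with the Hamiltonian functions is the infinitesimal action. -/
theorem poisson_hamiltonian {f : M → ℂ} (hf : C.IsHolomorphic f) (x : LieAlg E G) (m : M) :
    C.poisson (C.hamiltonian x) f m = -derivAtOne (fun g : G => f (C.act g m)) x := by
  have hz := C.isCodifferential_codifferential ⟨x, C.isCodifferential_hamiltonian x m⟩
  have hx := C.isCodifferential_hamiltonian x m
  have hw := C.isCodifferential_codifferential (C.exists_isCodifferential hf m)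
  set z := C.codifferential (C.hamiltonian x) m
  set w := C.codifferential f m
  set y := (C.κ m).val
  -- The chosen codifferential `z` of `φˣ` agrees with `x` only modulo the centralizer of `y`, which
  -- does not affect the bracket with `y`.
  have hlie : ⁅z, y⁆ = ⁅x, y⁆ := by
    rw [← sub_eq_zero, ← sub_lie]
    refine (LieAlgebra.IsKilling.killingForm_nondegenerate ℂ (LieAlg E G)).1 _ fun v => ?_
    have h1 : killingForm ℂ (LieAlg E G) (z - x) ⁅v, y⁆ = 0 := by
      rw [map_sub, LinearMap.sub_apply, ← hz v, ← hx v, sub_self]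
    rw [LieModule.traceForm_apply_lie_apply, ← lie_skew, map_neg, h1, neg_zero]
  change killingForm ℂ (LieAlg E G) y ⁅z, w⁆ = _
  rw [← LieModule.traceForm_apply_lie_apply, ← lie_skew, hlie, map_neg, LinearMap.neg_apply,
    hw x, LieModule.traceForm_comm]

end OrbitCover

/-! ### Invariants of Dixmier algebras -/

/-- A finite-dimensional submodule of a module over a Lie algebra with nondegenerate Killing form
decomposes into invariants and brackets. -/
theorem exists_invariant_sub_mem_span {L W : Type*} [LieRing L] [LieAlgebra ℂ L]
    [FiniteDimensional ℂ L] [LieAlgebra.IsKilling ℂ L] [AddCommGroup W] [Module ℂ W]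
    [LieRingModule L W] [LieModule ℂ L W]
    (V : Submodule ℂ W) [FiniteDimensional ℂ V] (hV : ∀ x : L, ∀ v ∈ V, ⁅x, v⁆ ∈ V) :
    (∀ v ∈ V, ∃ u ∈ V, (∀ x : L, ⁅x, u⁆ = 0) ∧
      v - u ∈ Submodule.span ℂ {d | ∃ x : L, ∃ w ∈ V, ⁅x, w⁆ = d}) ∧
    ∀ u ∈ V, (∀ x : L, ⁅x, u⁆ = 0) →
      u ∈ Submodule.span ℂ {d | ∃ x : L, ∃ w ∈ V, ⁅x, w⁆ = d} → u = 0 := by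
  let N : LieSubmodule ℂ L W := { V with lie_mem := fun {x v} hv => hV x v hv }
  have : FiniteDimensional ℂ N := inferInstanceAs (FiniteDimensional ℂ V)
  have hC := isCompl_maxTrivSubmodule_lie_top ℂ L N
  have hlie : ∀ (x : L) (n : N), ((⁅x, n⁆ : N) : W) = ⁅x, (n : W)⁆ := fun _ _ => rfl
  have hspan : ((⁅(⊤ : LieIdeal ℂ L), (⊤ : LieSubmodule ℂ L N)⁆ : LieSubmodule ℂ L N) :
      Submodule ℂ N).map (N : Submodule ℂ W).subtype =
      Submodule.span ℂ {d | ∃ x : L, ∃ w ∈ V, ⁅x, w⁆ = d} := by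
    rw [LieSubmodule.lieIdeal_oper_eq_linear_span', Submodule.map_span]
    congr 1
    ext d
    constructor
    · rintro ⟨_, ⟨x, -, n, -, rfl⟩, rfl⟩
      exact ⟨x, n, n.2, rfl⟩
    · rintro ⟨x, w, hw, rfl⟩
      exact ⟨_, ⟨x, trivial, ⟨w, hw⟩, trivial, rfl⟩, rfl⟩
  rw [← hspan]
  constructor
  · intro v hv
    have h1 : (⟨v, hv⟩ : N) ∈ LieModule.maxTrivSubmodule ℂ L N ⊔
        ⁅(⊤ : LieIdeal ℂ L), (⊤ : LieSubmodule ℂ L N)⁆ := by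
      rw [hC.sup_eq_top]; trivial
    obtain ⟨u, hu, w, hw, huw⟩ := (LieSubmodule.mem_sup _ _ _).1 h1
    refine ⟨u, u.2, fun x => ?_, w, hw, ?_⟩
    · rw [← hlie, (LieModule.mem_maxTrivSubmodule _ _ _ _).1 hu x]; rfl
    · exact (sub_eq_of_eq_add' (congrArg Subtype.val huw).symm).symm
  · rintro _ - hu ⟨u', hu', rfl⟩
    obtain ⟨u, rfl⟩ : ∃ u : N, u = u' := ⟨u', rfl⟩
    have h1 : u ∈ LieModule.maxTrivSubmodule ℂ L N ⊓
        ⁅(⊤ : LieIdeal ℂ L), (⊤ : LieSubmodule ℂ L N)⁆ :=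
      (LieSubmodule.mem_inf _ _ _).2
        ⟨(LieModule.mem_maxTrivSubmodule _ _ _ _).2 fun x => Subtype.ext (hu x), hu'⟩
    rw [hC.inf_eq_bot, LieSubmodule.mem_bot] at h1
    rw [h1]; rfl

namespace DixmierData

variable {E : Type*} [NormedAddCommGroup E] [NormedSpace ℂ E] [CompleteSpace E]
  {G : Type*} [TopologicalSpace G] [ChartedSpace E G] [Group G] [LieGroup 𝓘(ℂ, E) ω G]
  {e : LieAlg E G} {M : Type*} [TopologicalSpace M]
  {C : OrbitCover e M} {D : Type*} [Ring D] [Algebra ℂ D] (A : DixmierData C D)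

/-- The action of the Lie algebra on `D` by the commutators with the elements `ψ x`. -/
abbrev lieRingModule : LieRingModule (LieAlg E G) D where
  bracket x a := A.ψ x * a - a * A.ψ x
  add_lie x y a := by simp only [map_add]; noncomm_ring
  lie_add x a b := by noncomm_ring
  leibniz_lie x y a := by
    change _ = (A.ψ ⁅x, y⁆ * a - a * A.ψ ⁅x, y⁆) + _
    rw [A.ψ_lie]; noncomm_ring

theorem lieModule : @LieModule ℂ (LieAlg E G) D _ _ _ _ _ A.lieRingModule :=
  let := A.lieRingModule
  { smul_lie := fun c x a => by
      change A.ψ (c • x) * a - a * A.ψ (c • x) = c • (A.ψ x * a - a * A.ψ x)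
      rw [map_smul, smul_mul_assoc, mul_smul_comm, smul_sub]
    lie_smul := fun c x a => by
      change A.ψ x * (c • a) - (c • a) * A.ψ x = c • (A.ψ x * a - a * A.ψ x)
      rw [smul_mul_assoc, mul_smul_comm, smul_sub] }

/-- The span of the commutators `ψ x * a - a * ψ x` with `a` in a subspace. -/
def commutatorSpan (V : Submodule ℂ D) : Submodule ℂ D :=
  Submodule.span ℂ {d | ∃ x, ∃ w ∈ V, A.ψ x * w - w * A.ψ x = d}

theorem commutatorSpan_mono {V W : Submodule ℂ D} (h : V ≤ W) :
    A.commutatorSpan V ≤ A.commutatorSpan W :=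
  Submodule.span_mono fun _ ⟨x, w, hw, hd⟩ => ⟨x, w, h hw, hd⟩

/-- Local finiteness confines a finite sum of commutators to a finite-dimensional stable subspace,
where the decomposition theorem applies. -/
theorem exists_mem_commutatorSpan {d : D} (hd : d ∈ A.commutatorSpan ⊤) :
    ∃ V : Submodule ℂ D, V.FG ∧ (∀ x, ∀ v ∈ V, A.ψ x * v - v * A.ψ x ∈ V) ∧
      d ∈ A.commutatorSpan V := by
  refine Submodule.span_induction ?_ ?_ ?_ ?_ hd
  · rintro _ ⟨x, w, -, rfl⟩
    obtain ⟨V, hV, hw, hs, -⟩ := A.ρ_locallyFinite w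
    exact ⟨V, hV, hs, Submodule.subset_span ⟨x, w, hw, rfl⟩⟩
  · exact ⟨⊥, Submodule.fg_bot, fun x v hv => by simp [(Submodule.mem_bot ℂ).1 hv], zero_mem _⟩
  · rintro a b - - ⟨V, hV, hVs, ha⟩ ⟨W, hW, hWs, hb⟩
    refine ⟨V ⊔ W, hV.sup hW, fun x v hv => ?_,
      add_mem (A.commutatorSpan_mono le_sup_left ha) (A.commutatorSpan_mono le_sup_right hb)⟩
    obtain ⟨y, hy, z, hz, rfl⟩ := Submodule.mem_sup.1 hv
    rw [show A.ψ x * (y + z) - (y + z) * A.ψ x =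
      (A.ψ x * y - y * A.ψ x) + (A.ψ x * z - z * A.ψ x) by noncomm_ring]
    exact Submodule.add_mem_sup (hVs x y hy) (hWs x z hz)
  · rintro c a - ⟨V, hV, hVs, ha⟩
    exact ⟨V, hV, hVs, Submodule.smul_mem _ c ha⟩

/-- The symbol in degree `n` of an element of `F n`, as a function on the cover. -/
def symbol {n : ℤ} (a : A.F n) : M → ℂ := (A.γ n (grProj A.F n a) : M → ℂ)

theorem symbol_mem {n : ℤ} (a : A.F n) : A.symbol a ∈ C.gradedPiece n :=
  (A.γ n (grProj A.F n a)).2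

theorem symbol_eq_zero {n : ℤ} {a : A.F n} : A.symbol a = 0 ↔ (a : D) ∈ A.F (n - 1) := by
  rw [symbol, ZeroMemClass.coe_eq_zero, LinearEquiv.map_eq_zero_iff, Submodule.mkQ_apply,
    Submodule.Quotient.mk_eq_zero, Submodule.submoduleOf, Submodule.mem_comap,
    Submodule.subtype_apply]

theorem symbol_add {n : ℤ} (a b : A.F n) : A.symbol (a + b) = A.symbol a + A.symbol b := by
  simp only [symbol, map_add, Submodule.coe_add]

theorem symbol_smul {n : ℤ} (c : ℂ) (a : A.F n) : A.symbol (c • a) = c • A.symbol a := by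
  simp only [symbol, map_smul, Submodule.coe_smul]

theorem symbol_sum {n : ℤ} {ι : Type*} (s : Finset ι) (a : ι → A.F n) :
    A.symbol (∑ i ∈ s, a i) = ∑ i ∈ s, A.symbol (a i) := by
  simp only [symbol, map_sum, Submodule.coe_sum]

/-- The linear functionals on `D` which vanish on all commutators `ψ x * a - a * ψ x`. -/
def IsInvariant (T : D →ₗ[ℂ] ℂ) : Prop := ∀ x a, T (A.ψ x * a - a * A.ψ x) = 0

variable {A} in
theorem IsInvariant.map_eq_zero {T : D →ₗ[ℂ] ℂ} (hT : A.IsInvariant T) {V : Submodule ℂ D} {d : D}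
    (hd : d ∈ A.commutatorSpan V) : T d = 0 := by
  refine (Submodule.span_le (p := LinearMap.ker T)).2 ?_ hd
  rintro _ ⟨x, w, -, rfl⟩
  exact hT x w

-- Infinitesimal invariance integrates over the connected group; the supertrace axiom is stated for
-- `G`-invariant functionals.
variable {A} in
theorem IsInvariant.map_rho [PreconnectedSpace G] {T : D →ₗ[ℂ] ℂ} (hT : A.IsInvariant T) (g : G) (a : D) :
    T (A.ρ g a) = T a := by
  have h := eq_const_of_derivAtOne_eq_zero (A.ρ_holomorphic a T) (fun k x => ?_) g
  · simpa using h
  · have h2 := A.ρ_deriv (A.ρ k a) T x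
    rw [hT] at h2
    simpa only [map_mul, AlgEquiv.mul_apply] using h2

/-! ### Invariants are scalars, and the invariant functional exists. -/

variable [FiniteDimensional ℂ E] [LieAlgebra.IsSemisimple ℂ (LieAlg E G)]

/-- The symbol of an invariant is constant. -/
theorem symbol_apply_eq_of_commute [PreconnectedSpace M] [PreconnectedSpace G] {n : ℤ} (a : A.F n)
    (ha : ∀ x, A.ψ x * a - a * A.ψ x = 0) (m m' : M) : A.symbol a m = A.symbol a m' := by
  refine C.eq_of_derivAtOne_eq_zero (A.symbol_mem a).1.1 (fun m x => ?_) m m'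
  rw [← neg_eq_zero, ← C.poisson_hamiltonian (A.symbol_mem a).1.1, ← A.γ_ψ]
  refine (congrFun (A.γ_poisson ⟨A.ψ x, A.ψ_mem x⟩ a) m).symm.trans ?_
  have h : A.symbol (n := 2 + n - 2) ⟨A.ψ x * a - a * A.ψ x, A.comm_mem (A.ψ_mem x) a.2⟩ = 0 := by
    rw [A.symbol_eq_zero]
    exact (congrArg (· ∈ A.F (2 + n - 2 - 1)) (ha x)).mpr (zero_mem _)
  exact congrFun h m

theorem eq_algebraMap_of_commute [ConnectedSpace M] [PreconnectedSpace G] {a : D}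
    (ha : ∀ x, A.ψ x * a - a * A.ψ x = 0) : ∃ c : ℂ, a = algebraMap ℂ D c := by
  obtain ⟨n, hn⟩ := A.F_exhaust a
  obtain ⟨k, hk⟩ : ∃ k : ℕ, a ∈ A.F k := ⟨n.toNat, A.F_mono (Int.self_le_toNat n) hn⟩
  clear hn n
  obtain ⟨m₀⟩ := (inferInstance : Nonempty M)
  induction k with
  | zero =>
    let c := A.symbol ⟨a, hk⟩ m₀
    have h1 : A.symbol ⟨1, A.one_mem⟩ = 1 := A.γ_one
    have h : A.symbol (⟨a, hk⟩ + (-c) • ⟨1, A.one_mem⟩ : A.F 0) = 0 := by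
      rw [A.symbol_add, A.symbol_smul, h1]
      funext m
      simp [c, A.symbol_apply_eq_of_commute ⟨a, hk⟩ ha m m₀]
    rw [A.symbol_eq_zero, A.F_neg _ (by norm_num), Submodule.mem_bot] at h
    refine ⟨c, ?_⟩
    rw [Algebra.algebraMap_eq_smul_one, ← sub_eq_zero, ← h]
    simp [sub_eq_add_neg]
  | succ k ih =>
    refine ih ?_
    have h : A.symbol ⟨a, hk⟩ = 0 := by
      funext m
      -- Scaling by `t = 2` multiplies the constant symbol by `2 ^ (k + 1) ≠ 1`, so it is zero and
      -- the degree drops.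
      have h2 := (A.symbol_mem ⟨a, hk⟩).2 (Units.mk0 2 two_ne_zero) m
      rw [A.symbol_apply_eq_of_commute ⟨a, hk⟩ ha _ m, zpow_natCast] at h2
      have h3 : (2 : ℂ) ^ (k + 1) ≠ 1 := by
        have : (2 : ℕ) ^ (k + 1) ≠ 1 := by simp
        exact_mod_cast this
      have h4 : (2 ^ (k + 1) - 1) * A.symbol ⟨a, hk⟩ m = 0 := by
        rw [sub_mul, one_mul, sub_eq_zero]
        exact h2.symm
      exact (mul_eq_zero.1 h4).resolve_left (sub_ne_zero.2 h3)
    rw [A.symbol_eq_zero] at h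
    simpa using h

/-- As an invariant, `1` cannot be a nonzero sum of commutators, so some functional kills the
commutators but not `1`. -/
theorem exists_isInvariant [Nontrivial D] : ∃ T : D →ₗ[ℂ] ℂ, A.IsInvariant T ∧ T 1 = 1 := by
  have h1 : (1 : D) ∉ A.commutatorSpan ⊤ := by
    intro h
    obtain ⟨V, hV, hs, hV1⟩ := A.exists_mem_commutatorSpan h
    let := A.lieRingModule
    have := A.lieModule
    have := Module.Finite.iff_fg.2 hV
    have hle : A.commutatorSpan V ≤ V := by
      refine Submodule.span_le.2 ?_
      rintro _ ⟨x, w, hw, rfl⟩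
      exact hs x w hw
    refine one_ne_zero ((exists_invariant_sub_mem_span (L := LieAlg E G) V hs).2 1 (hle hV1)
      (fun x => ?_) hV1)
    change A.ψ x * 1 - 1 * A.ψ x = 0
    simp
  obtain ⟨f, hf, hle⟩ := Submodule.exists_le_ker_of_notMem h1
  refine ⟨(f 1)⁻¹ • f, fun x a => ?_, by simp [hf]⟩
  have : f (A.ψ x * a - a * A.ψ x) = 0 := hle (Submodule.subset_span ⟨x, a, trivial, rfl⟩)
  simp [this]

section Invariants

variable [ConnectedSpace M] [PreconnectedSpace G]

/-- An element of a subspace which is stable under commutators with the `ψ x` is the sum of a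
scalar in that subspace and of commutators. -/
theorem exists_algebraMap_mem {I : Submodule ℂ D}
    (hI : ∀ x, ∀ a ∈ I, A.ψ x * a - a * A.ψ x ∈ I) {a : D} (ha : a ∈ I) :
    ∃ c : ℂ, algebraMap ℂ D c ∈ I ∧ a - algebraMap ℂ D c ∈ A.commutatorSpan ⊤ := by
  obtain ⟨V, hV, haV, hs, -⟩ := A.ρ_locallyFinite a
  let := A.lieRingModule
  have := A.lieModule
  have := Module.Finite.iff_fg.2 hV
  have : FiniteDimensional ℂ ↥(V ⊓ I) := Submodule.finiteDimensional_of_le inf_le_left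
  obtain ⟨u, hu, hux, hau⟩ := (exists_invariant_sub_mem_span (L := LieAlg E G) (V ⊓ I)
    fun x v hv => ⟨hs x v hv.1, hI x v hv.2⟩).1 a ⟨haV, ha⟩
  obtain ⟨c, rfl⟩ := A.eq_algebraMap_of_commute hux
  exact ⟨c, hu.2, A.commutatorSpan_mono (V := V ⊓ I) le_top hau⟩

variable {A}

theorem IsInvariant.eq {T T' : D →ₗ[ℂ] ℂ} (hT : A.IsInvariant T) (hT' : A.IsInvariant T')
    (h1 : T 1 = T' 1) : T = T' := by
  ext a
  obtain ⟨c, -, hc⟩ := A.exists_algebraMap_mem (I := ⊤) (fun _ _ _ => trivial) (a := a) trivial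
  have h := hT.map_eq_zero hc
  have h' := hT'.map_eq_zero hc
  rw [map_sub, sub_eq_zero, Algebra.algebraMap_eq_smul_one, map_smul] at h h'
  rw [h, h', h1]

/-- The Galois group fixes every `ψ x`, so `T ∘ s` is again invariant and uniqueness applies. -/
theorem IsInvariant.map_galois {T : D →ₗ[ℂ] ℂ} (hT : A.IsInvariant T) (s : C.deckGroup) (a : D) :
    T (A.galois s a) = T a := by
  have h : T ∘ₗ (A.galois s).toLinearMap = T :=
    IsInvariant.eq (A := A) (fun x a => by simpa [A.galois_ψ] using hT x (A.galois s a)) hT (by simp)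
  exact LinearMap.congr_fun h a

/-- An invariant functional vanishes on every stable subspace which contains no nonzero scalar. -/
theorem IsInvariant.map_eq_zero_of_mem {T : D →ₗ[ℂ] ℂ} (hT : A.IsInvariant T) {I : Submodule ℂ D}
    (hI : ∀ x, ∀ a ∈ I, A.ψ x * a - a * A.ψ x ∈ I) (h1 : (1 : D) ∉ I) {a : D} (ha : a ∈ I) :
    T a = 0 := by
  obtain ⟨c, hcI, hc⟩ := A.exists_algebraMap_mem hI ha
  have hc0 : c = 0 := by
    by_contra hc0
    refine h1 ?_
    have := I.smul_mem c⁻¹ hcI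
    rwa [Algebra.algebraMap_eq_smul_one, smul_smul, inv_mul_cancel₀ hc0, one_smul] at this
  simpa [hc0] using hT.map_eq_zero hc

end Invariants

end DixmierData

/-! ### Simplicity -/

namespace DixmierData

variable {E : Type*} [NormedAddCommGroup E] [NormedSpace ℂ E] [CompleteSpace E]
  {G : Type*} [TopologicalSpace G] [ChartedSpace E G] [Group G] [LieGroup 𝓘(ℂ, E) ω G]
  {e : LieAlg E G} {M : Type*} [TopologicalSpace M]
  {C : OrbitCover e M} {D : Type*} [Ring D] [Algebra ℂ D] {A : DixmierData C D}

/-- Left and right radicals agree. Testing against the even and odd parts of `b` separately isolates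
the two parity components, and each may be commuted up to sign. -/
theorem IsSupertrace.map_mul_eq_zero_comm {T : D →ₗ[ℂ] ℂ} (hT : A.IsSupertrace T) {a : D}
    (ha : ∀ b, T (a * b) = 0) (b : D) : T (b * a) = 0 := by
  have hdec : ∀ a : D, ∃ x y, A.IsEven x ∧ A.IsOdd y ∧ a = x + y := fun a =>
    ⟨(2⁻¹ : ℂ) • (a + A.β (A.β a)), (2⁻¹ : ℂ) • (a - A.β (A.β a)),
      by simp [IsEven, A.β_four, add_comm],
      by simp [IsOdd, A.β_four, ← smul_neg],
      by rw [← smul_add, add_add_sub_cancel, ← two_smul ℂ a, smul_smul,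
          inv_mul_cancel₀ two_ne_zero, one_smul]⟩
  obtain ⟨a₀, a₁, ha₀, ha₁, rfl⟩ := hdec a
  obtain ⟨b₀, b₁, hb₀, hb₁, rfl⟩ := hdec b
  have h0 := ha b₀
  have h1 := ha b₁
  rw [add_mul, map_add, hT.odd_even _ _ ha₁ hb₀, add_zero, hT.even _ _ ha₀ hb₀] at h0
  rw [add_mul, map_add, hT.even_odd _ _ ha₀ hb₁, zero_add, hT.odd _ _ ha₁ hb₁, neg_eq_zero] at h1
  rw [add_mul, mul_add, mul_add, map_add, map_add, map_add, h0, h1, hT.even_odd _ _ hb₀ ha₁,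
    hT.odd_even _ _ hb₁ ha₀]
  simp

/-- The radical of a supertrace. -/
def IsSupertrace.radical {T : D →ₗ[ℂ] ℂ} (hT : A.IsSupertrace T) : TwoSidedIdeal D :=
  TwoSidedIdeal.mk' {a | ∀ b, T (a * b) = 0} (fun b => by simp)
    (fun {x y} hx hy b => by rw [add_mul, map_add, hx b, hy b, add_zero])
    (fun {x} hx b => by rw [neg_mul, map_neg, hx b, neg_zero])
    (fun {x y} hy b => by
      rw [mul_assoc]
      exact hT.map_mul_eq_zero_comm (fun c => by rw [mul_assoc]; exact hy _) x)
    (fun {x y} hx b => by rw [mul_assoc]; exact hx _)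

theorem IsSupertrace.mem_radical {T : D →ₗ[ℂ] ℂ} (hT : A.IsSupertrace T) {a : D} :
    a ∈ hT.radical ↔ ∀ b, T (a * b) = 0 :=
  TwoSidedIdeal.mem_mk' ..

theorem IsSupertrace.one_notMem_radical {T : D →ₗ[ℂ] ℂ} (hT : A.IsSupertrace T) (h1 : T 1 = 1) :
    (1 : D) ∉ hT.radical := fun h => by
  have := hT.mem_radical.1 h 1
  simp [h1] at this

variable (A)

theorem nontrivial (A : DixmierData C D) [Nonempty M] : Nontrivial D := by
  by_contra h
  rw [not_nontrivial_iff_subsingleton] at h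
  obtain ⟨m⟩ := (inferInstance : Nonempty M)
  have h0 : A.symbol ⟨1, A.one_mem⟩ = 0 := by
    rw [A.symbol_eq_zero]
    exact (congrArg (· ∈ A.F (0 - 1)) (Subsingleton.elim (1 : D) 0)).mpr (zero_mem _)
  exact one_ne_zero (congrFun (A.γ_one.symm.trans h0) m)

theorem symbol_galois (s : C.deckGroup) {n : ℤ} (a : A.F n) (p : M) :
    A.symbol ⟨A.galois s a, A.galois_mem s a.2⟩ p = A.symbol a (s⁻¹.1 p) :=
  A.γ_galois s a p

/-- If every symbol vanished, the element would descend through the filtration to degree `-1`, where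
it is zero. -/
theorem exists_symbol_ne_zero {a : D} (ha : a ≠ 0) :
    ∃ (n : ℤ) (h : a ∈ A.F n), A.symbol ⟨a, h⟩ ≠ 0 := by
  obtain ⟨n, hn⟩ := A.F_exhaust a
  obtain ⟨k, hk⟩ : ∃ k : ℕ, a ∈ A.F k := ⟨n.toNat, A.F_mono (Int.self_le_toNat n) hn⟩
  clear hn n
  by_contra! h
  induction k with
  | zero =>
    have h0 := A.symbol_eq_zero.1 (h _ hk)
    rw [A.F_neg _ (by norm_num)] at h0
    exact ha ((Submodule.mem_bot ℂ).1 h0)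
  | succ k ih =>
    refine ih ?_
    have h0 := A.symbol_eq_zero.1 (h _ hk)
    simpa using h0

/-- In a two-sided ideal, the product of the Galois conjugates of an element has the product of
the conjugates of its symbol as a symbol. -/
theorem exists_symbol_eq_prod {I : TwoSidedIdeal D} (hI : ∀ s, ∀ a ∈ I, A.galois s a ∈ I)
    {n : ℤ} (a : A.F n) (ha : (a : D) ∈ I) (l : List C.deckGroup) :
    ∃ (k : ℤ) (b : A.F k), (l ≠ [] → (b : D) ∈ I) ∧
      A.symbol b = (l.map fun s => A.symbol ⟨A.galois s a, A.galois_mem s a.2⟩).prod := by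
  induction l with
  | nil => exact ⟨0, ⟨1, A.one_mem⟩, fun h => (h rfl).elim, A.γ_one⟩
  | cons s l ih =>
    obtain ⟨k, b, -, hb⟩ := ih
    refine ⟨n + k, ⟨A.galois s a * b, A.mul_mem (A.galois_mem s a.2) b.2⟩, fun _ =>
      I.mul_mem_right _ _ (hI s a ha), ?_⟩
    rw [List.map_cons, List.prod_cons, ← hb]
    exact A.γ_mul ⟨A.galois s a, A.galois_mem s a.2⟩ b

/-- Conjugation composes a symbol with a homeomorphism of `M`, so no factor vanishes, and
holomorphic functions on `M` have no zero divisors. -/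
theorem prod_symbol_ne_zero [ConnectedSpace M] [PreconnectedSpace G] {n : ℤ} {a : A.F n}
    (ha : A.symbol a ≠ 0) (l : List C.deckGroup) :
    C.IsHolomorphic (l.map fun s => A.symbol ⟨A.galois s a, A.galois_mem s a.2⟩).prod ∧
    (l.map fun s => A.symbol ⟨A.galois s a, A.galois_mem s a.2⟩).prod ≠ 0 := by
  induction l with
  | nil =>
    obtain ⟨m⟩ := (inferInstance : Nonempty M)
    exact ⟨C.regularFunctions.one_mem.1, fun h => one_ne_zero (congrFun h m)⟩
  | cons s l ih =>
    rw [List.map_cons, List.prod_cons]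
    have hs := A.symbol_mem ⟨A.galois s a, A.galois_mem s a.2⟩
    refine ⟨fun m => (hs.1.1 m).mul (ih.1 m), fun h => ?_⟩
    refine (C.eq_zero_or_eq_zero hs.1.1 ih.1 h).elim (fun h0 => ha ?_) ih.2
    funext p
    have := congrFun h0 (s.1 p)
    rw [A.symbol_galois] at this
    have hp : s⁻¹.1 (s.1 p) = p := s.1.symm_apply_apply p
    rwa [hp] at this

/-- A nonzero two-sided ideal which is stable under the Galois group contains a nonzero
invariant. -/
theorem exists_invariant_mem [ConnectedSpace M] [PreconnectedSpace G] {I : TwoSidedIdeal D}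
    (hI : ∀ s, ∀ a ∈ I, A.galois s a ∈ I) {a : D} (ha : a ∈ I) (ha0 : a ≠ 0) :
    ∃ b ∈ I, b ∈ A.invariants ∧ b ≠ 0 := by
  classical
  have := C.finite_deckGroup
  have := Fintype.ofFinite C.deckGroup
  obtain ⟨n, hn, hsym⟩ := A.exists_symbol_ne_zero ha0
  obtain ⟨k, b, hbI, hb⟩ := A.exists_symbol_eq_prod hI ⟨a, hn⟩ ha
    (Finset.univ : Finset C.deckGroup).toList
  have hb0 : A.symbol b ≠ 0 := hb ▸ (A.prod_symbol_ne_zero hsym _).2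
  have hbI := hbI (by simp [← List.length_eq_zero_iff, Fintype.card_ne_zero])
  rw [Finset.prod_map_toList] at hb
  have hinv : ∀ s : C.deckGroup, A.symbol ⟨A.galois s b, A.galois_mem s b.2⟩ = A.symbol b := by
    intro s
    funext p
    rw [A.symbol_galois, hb, Finset.prod_apply, Finset.prod_apply]
    refine Fintype.prod_equiv (Equiv.mulLeft s) _ _ fun t => ?_
    have h : (s * t)⁻¹.1 p = t⁻¹.1 (s⁻¹.1 p) := by
      rw [mul_inv_rev]; rfl
    exact ((A.symbol_galois t ⟨a, hn⟩ _).trans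
      ((congrArg (A.symbol ⟨a, hn⟩) h).symm.trans (A.symbol_galois (s * t) ⟨a, hn⟩ p).symm))
  -- The norm `b` need not be invariant, only its symbol. The average has symbol `|𝒮|` times that of
  -- `b`, so it cannot vanish.
  refine ⟨∑ s, A.galois s b, sum_mem fun s _ => hI s _ hbI, fun s => ?_, fun h => hb0 ?_⟩
  · rw [map_sum]
    refine Fintype.sum_equiv (Equiv.mulLeft s) _ _ fun t => ?_
    rw [Equiv.coe_mulLeft, map_mul]
    rfl
  · have h1 : A.symbol (∑ s, ⟨A.galois s b, A.galois_mem s b.2⟩ : A.F k) = 0 := by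
      rw [A.symbol_eq_zero, AddSubmonoidClass.coe_finsetSum, h]
      exact zero_mem _
    rw [A.symbol_sum, Finset.sum_congr rfl fun s _ => hinv s, Finset.sum_const,
      ← Nat.cast_smul_eq_nsmul ℂ] at h1
    exact (smul_eq_zero.1 h1).resolve_left (by simp)

/-! ### The radical of the supertrace decides simplicity. -/

variable [FiniteDimensional ℂ E] [LieAlgebra.IsSemisimple ℂ (LieAlg E G)]
  [ConnectedSpace M] [PreconnectedSpace G] {A}

/-- An invariant functional vanishes on the proper two-sided ideals of the subalgebras which
contain the image of the Lie algebra. -/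
theorem IsInvariant.map_eq_zero_of_ne_top {T : D →ₗ[ℂ] ℂ} (hT : A.IsInvariant T)
    {B : Type*} [Ring B] [Algebra ℂ B] (f : B →ₐ[ℂ] D) (hf : Function.Injective f)
    (hB : ∀ x, ∃ b, f b = A.ψ x) {J : TwoSidedIdeal B} (hJ : J ≠ ⊤) {a : B} (ha : a ∈ J) :
    T (f a) = 0 := by
  let I : Submodule ℂ D :=
    { carrier := {d | ∃ b ∈ J, f b = d}
      zero_mem' := ⟨0, J.zero_mem, map_zero f⟩
      add_mem' := by
        rintro _ _ ⟨b, hb, rfl⟩ ⟨c, hc, rfl⟩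
        exact ⟨b + c, J.add_mem hb hc, map_add f b c⟩
      smul_mem' := by
        rintro c _ ⟨b, hb, rfl⟩
        refine ⟨c • b, ?_, map_smul f c b⟩
        rw [Algebra.smul_def]
        exact J.mul_mem_left _ _ hb }
  refine hT.map_eq_zero_of_mem (I := I) ?_ ?_ ⟨a, ha, rfl⟩
  · rintro x _ ⟨b, hb, rfl⟩
    obtain ⟨y, hy⟩ := hB x
    exact ⟨y * b - b * y, J.sub_mem (J.mul_mem_left _ _ hb) (J.mul_mem_right _ _ hb), by
      simp [hy]⟩
  · rintro ⟨b, hb, hb1⟩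
    obtain rfl : b = 1 := hf (hb1.trans (map_one f).symm)
    exact hJ (J.one_mem_iff.1 hb)

/-- The radical of the supertrace is stable under the Galois group. -/
theorem IsInvariant.galois_mem_radical {T : D →ₗ[ℂ] ℂ} (hT : A.IsInvariant T)
    (hS : A.IsSupertrace T) (s : C.deckGroup) {a : D} (ha : a ∈ hS.radical) :
    A.galois s a ∈ hS.radical := by
  rw [hS.mem_radical] at ha ⊢
  intro b
  rw [← hT.map_galois s⁻¹, map_mul, ← AlgEquiv.mul_apply, ← map_mul, inv_mul_cancel, map_one]
  exact ha _

theorem isSimpleRing_invariants [Nontrivial D] {T : D →ₗ[ℂ] ℂ} (hT : A.IsInvariant T)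
    (hS : A.IsSupertrace T) (hrad : hS.radical = ⊥) : IsSimpleRing A.invariants := by
  have := C.finite_deckGroup
  have := Fintype.ofFinite C.deckGroup
  refine ⟨⟨fun J => or_iff_not_imp_right.2 fun hJ => ?_⟩⟩
  refine le_bot_iff.1 fun a ha => ?_
  rw [TwoSidedIdeal.mem_bot, ← Subtype.coe_inj, ZeroMemClass.coe_zero,
    ← TwoSidedIdeal.mem_bot, ← hrad, hS.mem_radical]
  intro b
  have hsum : ∑ s, A.galois s b ∈ A.invariants := fun s => by
    rw [map_sum]
    refine Fintype.sum_equiv (Equiv.mulLeft s) _ _ fun t => ?_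
    rw [Equiv.coe_mulLeft, map_mul]
    rfl
  -- The average of `b` is in `D^𝒮`, so the product stays in the proper ideal. Since `a` and `T` are
  -- fixed by `𝒮`, the value is `|𝒮| * T (a * b)`.
  have h0 : T (a * ∑ s, A.galois s b) = 0 :=
    hT.map_eq_zero_of_ne_top A.invariants.val Subtype.val_injective
      (fun x => ⟨⟨A.ψ x, fun s => A.galois_ψ s x⟩, rfl⟩) hJ (J.mul_mem_right a ⟨_, hsum⟩ ha)
  have h1 : ∀ s, T (a * A.galois s b) = T (a * b) := fun s => by
    rw [← hT.map_galois s (a * b), map_mul (A.galois s), a.2 s]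
  rw [Finset.mul_sum, map_sum, Finset.sum_congr rfl fun s _ => h1 s, Finset.sum_const,
    ← Nat.cast_smul_eq_nsmul ℂ] at h0
  exact (smul_eq_zero.1 h0).resolve_left (by simp)

theorem isSimpleRing_of_radical_eq_bot [Nontrivial D] {T : D →ₗ[ℂ] ℂ} (hT : A.IsInvariant T)
    (hS : A.IsSupertrace T) (hrad : hS.radical = ⊥) : IsSimpleRing D := by
  refine ⟨⟨fun J => or_iff_not_imp_right.2 fun hJ => ?_⟩⟩
  rw [← le_bot_iff, ← hrad]
  intro a ha
  exact hS.mem_radical.2 fun b => hT.map_eq_zero_of_ne_top (AlgHom.id ℂ D)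
    Function.injective_id (fun x => ⟨_, rfl⟩) hJ (J.mul_mem_right a b ha)

theorem radical_eq_bot [IsSimpleRing A.invariants] {T : D →ₗ[ℂ] ℂ} (hT : A.IsInvariant T)
    (hT1 : T 1 = 1) (hS : A.IsSupertrace T) : hS.radical = ⊥ := by
  refine le_bot_iff.1 fun a ha => ?_
  rw [TwoSidedIdeal.mem_bot]
  by_contra ha0
  obtain ⟨b, hb, hbinv, hb0⟩ := A.exists_invariant_mem
    (fun s _ => hT.galois_mem_radical hS s) ha ha0
  -- The radical meets `D^𝒮` in a nonzero ideal, which by simplicity contains `1`, against `T 1 =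
  -- 1`.
  have h := IsSimpleRing.one_mem_of_ne_zero_mem (hS.radical.comap A.invariants.val)
    (x := ⟨b, hbinv⟩) (fun h => hb0 (congrArg Subtype.val h))
    ((TwoSidedIdeal.mem_comap _).2 hb)
  rw [TwoSidedIdeal.mem_comap, map_one] at h
  exact hS.one_notMem_radical hT1 h

variable (A) in
/-- A Dixmier algebra is simple if and only if its subalgebra of Galois invariants is simple. -/
theorem isSimpleRing_iff_isSimpleRing_invariants (hA : A.SupertraceAxiom) :
    IsSimpleRing D ↔ IsSimpleRing A.invariants := by
  have : Nontrivial D := A.nontrivial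
  obtain ⟨T, hT, hT1⟩ := A.exists_isInvariant
  have hS := hA T hT.map_rho hT1
  constructor
  · intro h
    refine isSimpleRing_invariants hT hS ((eq_bot_or_eq_top hS.radical).resolve_right fun h => ?_)
    exact hS.one_notMem_radical hT1 (h ▸ trivial)
  · intro h
    exact isSimpleRing_of_radical_eq_bot hT hS (radical_eq_bot hT hT1 hS)

end DixmierData

end Dixmier

end

theorem proposition3p2
    {E : Type*} [NormedAddCommGroup E] [NormedSpace ℂ E] [FiniteDimensional ℂ E] [CompleteSpace E]
    {G : Type*} [TopologicalSpace G] [ChartedSpace E G] [Group G] [LieGroup 𝓘(ℂ, E) ω G]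
    [SimplyConnectedSpace G] [LieAlgebra.IsSemisimple ℂ (Dixmier.LieAlg E G)]
    {e : Dixmier.LieAlg E G}
    (he : IsNilpotent (LieAlgebra.ad ℂ (Dixmier.LieAlg E G) e))
    (hspan : Submodule.span ℂ (Dixmier.orbitSet e) = ⊤)
    {M : Type*} [TopologicalSpace M] [ConnectedSpace M]
    (C : Dixmier.OrbitCover e M) (hC : C.IsGalois)
    {D : Type*} [Ring D] [Algebra ℂ D]
    (A : Dixmier.DixmierData C D) (hT : A.SupertraceAxiom) :
    IsSimpleRing D ↔ IsSimpleRing A.invariants :=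
  A.isSimpleRing_iff_isSimpleRing_invariants hT
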